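/- Let $w=\sqrt[4]{2}$, $K=\mathbb{Q}(w)$, with ring of integers $\mathcal{O}_K$, and let $u=w^2-1$, $v=w+1$, which are units of $\mathcal{O}_K$. Let $\sigma_1,\sigma_2$ be the two real embeddings of $K$ and $\sigma_3$ one of its two non-real complex embeddings. Let $i$ (resp. $j$) be the smallest positive integer $k$ such that $u^k$ (resp. $v^k$) is positive under every real embedding of $K$ (one has $i=1$, $j=2$). For $m,n\ge 1$ let $U_{m,n}=\langle u^{im},v^{jn}\rangle\subset\mathcal{O}_K^\times$, let $\mathcal{O}_K\rtimes U_{m,n}$ be the semidirect product with $(h_1,k_1)(h_2,k_2)=(h_1+k_1h_2,\,k_1k_2)$, and let $$X_{m,n}=(\mathbb{H}^2\times\mathbb{C})/(\mathcal{O}_K\rtimes U_{m,n})$$ be the Oeljeklaus--Toma threefold, the quotient by the action $$(h,k)\cdot(z_1,z_2,z_3)=(\sigma_1(h)+\sigma_1(k)z_1,\ \sigma_2(h)+\sigma_2(k)z_2,\ \sigma_3(h)+\sigma_3(k)z_3),$$ where $\mathbb{H}$ is the upper half plane. Let $M,N\in\mathrm{GL}_4(\mathbb{Z})$ be the matrices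 of multiplication by $u$ and $v$ on $\mathcal{O}_K$ in the basis $1,w,w^2,w^3$. Then for every integer $m\ge1$ the fundamental group of $X_{m,1}$ (at any base point) is isomorphic to $\mathbb{Z}^4\rtimes\mathbb{Z}^2$, where $(s,t)\in\mathbb{Z}^2$ acts on $\mathbb{Z}^4$ by the matrix $M^{ms}N^{2t}$, and the first integral singular homology group of $X_{m,1}$ is $$H_1(X_{m,1};\mathbb{Z})\cong\begin{cases}(\mathbb{Z}/2\mathbb{Z})^2\oplus\mathbb{Z}^2 & \text{if } 6\nmid m,\\ (\mathbb{Z}/2\mathbb{Z})^2\oplus\mathbb{Z}/7\mathbb{Z}\oplus\mathbb{Z}^2 & \text{if } 6\mid m.\end{cases}$$ -/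

import Mathlib

open scoped NumberField UpperHalfPlane

noncomputable section

namespace OTManifold

section General

variable (K : Type) [Field K]

/-- The totally positive units of the ring of integers of `K`: the units that are positive under
every homomorphism from `K` to the real numbers. -/
def totallyPositiveUnits : Subgroup (𝓞 K)ˣ where
  carrier := {x | ∀ σ : K →+* ℝ, 0 < σ ((x : 𝓞 K) : K)}
  one_mem' := fun σ => by simp
  mul_mem' := fun {a b} ha hb σ => by
    have := mul_pos (ha σ) (hb σ)
    simpa using this
  inv_mem' := fun {a} ha σ => by
    have h1 : σ ((a : 𝓞 K) : K) * σ (((a⁻¹ : (𝓞 K)ˣ) : 𝓞 K) : K) = 1 := by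
      rw [← map_mul, ← map_mul, Units.mul_inv, map_one, map_one]
    exact pos_of_mul_pos_right (by rw [h1]; exact one_pos) (ha σ).le

variable {K}

/-- A unit acts on the additive group of the ring of integers by multiplication. The additive group
is written multiplicatively, so that one can form semidirect products with it. -/
def unitAction (U : Subgroup (totallyPositiveUnits K)) : U →* MulAut (Multiplicative (𝓞 K)) where
  toFun k := AddEquiv.toMultiplicative
    (DistribMulAction.toAddEquiv (𝓞 K) ((k : totallyPositiveUnits K) : (𝓞 K)ˣ))
  map_one' := by
    refine MulEquiv.ext fun x => ?_
    exact congrArg Multiplicative.ofAdd (one_smul (𝓞 K)ˣ (Multiplicative.toAdd x))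
  map_mul' a b := by
    refine MulEquiv.ext fun x => ?_
    exact congrArg Multiplicative.ofAdd
      (mul_smul (((a : totallyPositiveUnits K) : (𝓞 K)ˣ)) ((b : totallyPositiveUnits K) : (𝓞 K)ˣ)
        (Multiplicative.toAdd x))

/-- The semidirect product of the additive group of the ring of integers with a group `U` of totally
positive units: `(h₁, k₁) (h₂, k₂) = (h₁ + k₁ h₂, k₁ k₂)`. -/
abbrev OTGroup (U : Subgroup (totallyPositiveUnits K)) : Type :=
  Multiplicative (𝓞 K) ⋊[unitAction U] U

namespace OTGroup

variable {U : Subgroup (totallyPositiveUnits K)}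

/-- The component `h` of `(h, k)`, as an element of `K`. -/
def trans (g : OTGroup U) : K := ((Multiplicative.toAdd g.left : 𝓞 K) : K)

/-- The component `k` of `(h, k)`, as an element of `K`. -/
def scale (g : OTGroup U) : K := ((((g.right : totallyPositiveUnits K) : (𝓞 K)ˣ) : 𝓞 K) : K)

lemma scale_pos (g : OTGroup U) (σ : K →+* ℝ) : 0 < σ g.scale :=
  (g.right : totallyPositiveUnits K).2 σ

@[simp] lemma trans_one : (1 : OTGroup U).trans = 0 := by simp [trans]

@[simp] lemma scale_one : (1 : OTGroup U).scale = 1 := by simp [scale]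

@[simp] lemma trans_mul (g g' : OTGroup U) :
    (g * g').trans = g.trans + g.scale * g'.trans := by
  have : Multiplicative.toAdd (g * g').left = Multiplicative.toAdd g.left +
      (((g.right : totallyPositiveUnits K) : (𝓞 K)ˣ) : 𝓞 K) * Multiplicative.toAdd g'.left := rfl
  rw [trans, this]
  exact (map_add (algebraMap (𝓞 K) K) _ _).trans
    (congrArg _ (map_mul (algebraMap (𝓞 K) K) _ _))

@[simp] lemma scale_mul (g g' : OTGroup U) : (g * g').scale = g.scale * g'.scale := by
  simp [scale]

end OTGroup

/-- The affine map `z ↦ σ h + (σ k) z` of the upper half plane, for `g = (h, k)`. -/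
def actH {U : Subgroup (totallyPositiveUnits K)} (σ : K →+* ℝ) (g : OTGroup U) (z : ℍ) : ℍ :=
  σ g.trans +ᵥ ((⟨σ g.scale, g.scale_pos σ⟩ : {x : ℝ // 0 < x}) • z)

lemma coe_actH {U : Subgroup (totallyPositiveUnits K)} (σ : K →+* ℝ) (g : OTGroup U) (z : ℍ) :
    (actH σ g z : ℂ) = (σ g.trans : ℂ) + (σ g.scale : ℂ) * z := by
  simp [actH]

/-- The action of `(h, k)` on `ℍ × ℍ × ℂ`:
`(z₁, z₂, z₃) ↦ (σ₁ h + (σ₁ k) z₁, σ₂ h + (σ₂ k) z₂, σ₃ h + (σ₃ k) z₃)`. -/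
abbrev otAction (σ₁ σ₂ : K →+* ℝ) (σ₃ : K →+* ℂ) (U : Subgroup (totallyPositiveUnits K)) :
    MulAction (OTGroup U) (ℍ × ℍ × ℂ) where
  smul g z := (actH σ₁ g z.1, actH σ₂ g z.2.1, σ₃ g.trans + σ₃ g.scale * z.2.2)
  one_smul z := by
    refine Prod.ext (UpperHalfPlane.ext ?_) (Prod.ext (UpperHalfPlane.ext ?_) ?_)
    · change (actH σ₁ (1 : OTGroup U) z.1 : ℂ) = _
      simp [coe_actH]
    · change (actH σ₂ (1 : OTGroup U) z.2.1 : ℂ) = _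
      simp [coe_actH]
    · change σ₃ (1 : OTGroup U).trans + σ₃ (1 : OTGroup U).scale * z.2.2 = _
      simp
  mul_smul g g' z := by
    refine Prod.ext (UpperHalfPlane.ext ?_) (Prod.ext (UpperHalfPlane.ext ?_) ?_)
    · change (actH σ₁ (g * g') z.1 : ℂ) = (actH σ₁ g (actH σ₁ g' z.1) : ℂ)
      simp only [coe_actH, OTGroup.trans_mul, OTGroup.scale_mul, map_add, map_mul]
      push_cast
      ring
    · change (actH σ₂ (g * g') z.2.1 : ℂ) = (actH σ₂ g (actH σ₂ g' z.2.1) : ℂ)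
      simp only [coe_actH, OTGroup.trans_mul, OTGroup.scale_mul, map_add, map_mul]
      push_cast
      ring
    · change σ₃ (g * g').trans + σ₃ (g * g').scale * z.2.2
        = σ₃ g.trans + σ₃ g.scale * (σ₃ g'.trans + σ₃ g'.scale * z.2.2)
      simp only [OTGroup.trans_mul, OTGroup.scale_mul, map_add, map_mul]
      ring

/-- The orbit space `X(K, U) = (ℍ² × ℂ) / (𝓞 K ⋊ U)`; it carries the quotient topology. -/
abbrev OTSpace (σ₁ σ₂ : K →+* ℝ) (σ₃ : K →+* ℂ) (U : Subgroup (totallyPositiveUnits K)) : Type :=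
  Quotient (@MulAction.orbitRel (OTGroup U) (ℍ × ℍ × ℂ) _ (otAction σ₁ σ₂ σ₃ U))

lemma exists_sq_totallyPositive (x : (𝓞 K)ˣ) : ∃ k : ℕ, 0 < k ∧ x ^ k ∈ totallyPositiveUnits K := by
  refine ⟨2, two_pos, fun σ => ?_⟩
  have hx : σ ((x : 𝓞 K) : K) ≠ 0 := by
    intro h
    have h1 : σ ((x : 𝓞 K) : K) * σ (((x⁻¹ : (𝓞 K)ˣ) : 𝓞 K) : K) = 1 := by
      rw [← map_mul, ← map_mul, Units.mul_inv, map_one, map_one]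
    rw [h, zero_mul] at h1
    exact zero_ne_one h1
  have := pow_pos (sq_pos_of_ne_zero hx) 1
  simpa using this

open Classical in
/-- The smallest positive exponent `k` for which `x ^ k` is totally positive. -/
def signExponent (x : (𝓞 K)ˣ) : ℕ := Nat.find (exists_sq_totallyPositive x)

open Classical in
/-- The smallest positive power of `x` that is totally positive, as a totally positive unit. -/
def positivePower (x : (𝓞 K)ˣ) : totallyPositiveUnits K :=
  ⟨x ^ signExponent x, (Nat.find_spec (exists_sq_totallyPositive x)).2⟩

end General

/-- The number field `K = ℚ(2^(1/4))`. -/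
abbrev K : Type := IntermediateField.adjoin ℚ {(2 : ℝ) ^ (1 / 4 : ℝ)}

lemma root_pow_four : ((2 : ℝ) ^ (1 / 4 : ℝ)) ^ 4 = 2 := by
  rw [← Real.rpow_natCast, ← Real.rpow_mul (by norm_num)]
  norm_num

/-- The generator `w = 2^(1/4)` of `K`. -/
def wK : K := ⟨(2 : ℝ) ^ (1 / 4 : ℝ), IntermediateField.mem_adjoin_simple_self ℚ _⟩

lemma wK_pow_four : wK ^ 4 = 2 := Subtype.ext root_pow_four

lemma isIntegral_wK : IsIntegral ℤ wK := by
  refine ⟨Polynomial.X ^ 4 - Polynomial.C 2, Polynomial.monic_X_pow_sub_C _ (by norm_num), ?_⟩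
  simp [wK_pow_four]

/-- The generator `w = 2^(1/4)`, as an algebraic integer. -/
def w : 𝓞 K := ⟨wK, isIntegral_wK⟩

lemma w_pow_four : w ^ 4 = 2 := by
  apply NumberField.RingOfIntegers.ext
  exact (map_pow (algebraMap (𝓞 K) K) w 4).trans
    (wK_pow_four.trans (map_ofNat (algebraMap (𝓞 K) K) 2).symm)

/-- The unit `u = w² - 1`. -/
def u : (𝓞 K)ˣ where
  val := w ^ 2 - 1
  inv := w ^ 2 + 1
  val_inv := by linear_combination w_pow_four
  inv_val := by linear_combination w_pow_four

/-- The unit `v = w + 1`. -/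
def v : (𝓞 K)ˣ where
  val := w + 1
  inv := w ^ 3 - w ^ 2 + w - 1
  val_inv := by linear_combination w_pow_four
  inv_val := by linear_combination w_pow_four

/-- The group `⟨u^(i m), v^(j n)⟩`, where `i` and `j` are the smallest positive exponents for which
`u^i` and `v^j` are totally positive. -/
def unitGroup (m n : ℕ) : Subgroup (totallyPositiveUnits K) :=
  Subgroup.closure {positivePower u ^ m, positivePower v ^ n}

/-- The Oeljeklaus--Toma threefold `X_{m,n}`. -/
abbrev X (σ₁ σ₂ : K →+* ℝ) (σ₃ : K →+* ℂ) (m n : ℕ) : Type :=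
  OTSpace σ₁ σ₂ σ₃ (unitGroup m n)

/-- The first singular homology group with integer coefficients. -/
abbrev H₁ (Y : Type) [TopologicalSpace Y] : Type :=
  ((AlgebraicTopology.singularHomologyFunctor (ModuleCat.{0} ℤ) 1).obj (ModuleCat.of ℤ ℤ)).obj
    (TopCat.of Y)

/-- The matrix of multiplication by `u` in the basis `1, w, w², w³`. -/
def M : GL (Fin 4) ℤ where
  val := !![-1, 0, 2, 0; 0, -1, 0, 2; 1, 0, -1, 0; 0, 1, 0, -1]
  inv := !![1, 0, 2, 0; 0, 1, 0, 2; 1, 0, 1, 0; 0, 1, 0, 1]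
  val_inv := by decide
  inv_val := by decide

/-- The matrix of multiplication by `v` in the basis `1, w, w², w³`. -/
def N : GL (Fin 4) ℤ where
  val := !![1, 0, 0, 2; 1, 1, 0, 0; 0, 1, 1, 0; 0, 0, 1, 1]
  inv := !![-1, 2, -2, 2; 1, -1, 2, -2; -1, 1, -1, 2; 1, -1, 1, -1]
  val_inv := by decide
  inv_val := by decide

lemma commute_M_N : Commute M N := Units.ext (by decide)

/-- An invertible integral matrix acts on column vectors by multiplication from the left. -/
def mulVecAction : GL (Fin 4) ℤ →* MulAut (Multiplicative (Fin 4 → ℤ)) where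
  toFun A := AddEquiv.toMultiplicative
    { toFun := fun x => (A : Matrix (Fin 4) (Fin 4) ℤ).mulVec x
      invFun := fun x => ((A⁻¹ : GL (Fin 4) ℤ) : Matrix (Fin 4) (Fin 4) ℤ).mulVec x
      left_inv := fun x => by
        simp only [Matrix.mulVec_mulVec, Units.inv_mul, Matrix.one_mulVec]
      right_inv := fun x => by
        simp only [Matrix.mulVec_mulVec, Units.mul_inv, Matrix.one_mulVec]
      map_add' := fun x y => Matrix.mulVec_add _ x y }
  map_one' := by
    refine MulEquiv.ext fun x => ?_
    exact congrArg Multiplicative.ofAdd (Matrix.one_mulVec (Multiplicative.toAdd x))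
  map_mul' A B := by
    refine MulEquiv.ext fun x => ?_
    exact congrArg Multiplicative.ofAdd (Matrix.mulVec_mulVec (Multiplicative.toAdd x)
      (A : Matrix (Fin 4) (Fin 4) ℤ) (B : Matrix (Fin 4) (Fin 4) ℤ)).symm

/-- The action of `ℤ²` on `ℤ⁴` in which `(s, t)` acts by the matrix `M^(a s) N^(b t)`. -/
def matrixAction (a b : ℕ) :
    Multiplicative ℤ × Multiplicative ℤ →* MulAut (Multiplicative (Fin 4 → ℤ)) :=
  mulVecAction.comp
    (MonoidHom.noncommCoprod (zpowersHom _ (M ^ a)) (zpowersHom _ (N ^ b)) (fun s t => by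
      simp only [zpowersHom_apply]
      exact ((commute_M_N.pow_pow a b).zpow_zpow _ _)))

end OTManifold

end

/-! The group `𝓞 K ⋊ U` with `U = U_{m,1}` acts on the simply connected space `ℍ × ℍ × ℂ` as a
covering group, so it is the fundamental group of the quotient; `H₁` is then the abelianization of
that group.

Covering property (`isQuotientCoveringMap_mk`): imaginary parts in the two half planes are only
rescaled, so if `g` moves a point very little, both logarithms of its unit part are small, and
`exists_forall_abs_log_lt` makes the unit part trivial. What remains is translation by an algebraic
integer that is small under `σ₁`, `σ₂` and `σ₃`, and such an integer is `0` by
`eq_zero_of_map_small`.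

Coordinates: `X ^ 4 - 2` is Eisenstein at `2` and its discriminant is a power of `2` up to sign, so
`𝓞 K = ℤ[w]`. Moreover `U` is free on `u ^ m` and `v ^ 2`. Multiplication by `u`, `v` becomes `M`,
`N`, which gives `nonempty_matrixGroup_mulEquiv`.

Homology: `hurewicz_one` identifies `H₁` with the abelianized fundamental group, and the
abelianization of `ℤ⁴ ⋊ ℤ²` is the group of coinvariants times `ℤ²`. The coinvariants are `ℤ[w] / (u
^ m - 1, v ^ 2 - 1)`. Since `2 = w ^ 4`, one has `v ^ 2 - 1 = w (w + 2) = w ^ 2 (1 + w ^ 3)`, where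
`1 + w ^ 3` has norm `7` up to sign. Hence `ℤ[w] / (v ^ 2 - 1)` is `ℤ[w] / (w ^ 2) = (ℤ/2)²` times
`𝔽₇`, with `w ↦ -2` in the second factor. The unit `u` is `1` modulo `w ^ 2`, and it is `3` in `𝔽₇`,
a primitive root. So the relation `u ^ m = 1` preserves the factor `(ℤ/2)²`, and it preserves `𝔽₇`
exactly when `6 ∣ m`, killing it otherwise. -/

noncomputable section

/-! ### Paths and singular 1-simplices -/

section SimplexPaths

open unitInterval

variable {Y : Type} [TopologicalSpace Y]

instance {n : ℕ} : ContractibleSpace (stdSimplex ℝ (Fin (n + 1))) :=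
  (convex_stdSimplex ℝ (Fin (n + 1))).contractibleSpace ⟨_, single_mem_stdSimplex ℝ 0⟩

/-- The straight path between two vertices of the standard simplex. -/
def simplexEdge {n : ℕ} (i j : Fin n) :
    Path (stdSimplex.vertex (S := ℝ) i) (stdSimplex.vertex (S := ℝ) j) where
  toFun t := ⟨(1 - (t : ℝ)) • Pi.single i 1 + (t : ℝ) • Pi.single j 1,
    convex_stdSimplex ℝ (Fin n) (single_mem_stdSimplex ℝ i) (single_mem_stdSimplex ℝ j)
      (sub_nonneg.2 t.2.2) t.2.1 (by ring)⟩
  continuous_toFun := by fun_prop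
  source' := by ext; simp
  target' := by ext; simp

lemma simplexEdge_coe {n : ℕ} (i j : Fin n) (t : I) :
    ⇑(simplexEdge i j t) = (1 - (t : ℝ)) • Pi.single i 1 + (t : ℝ) • Pi.single j 1 := rfl

lemma simplexEdge_zero_one (t : I) :
    simplexEdge 0 1 t = stdSimplexHomeomorphUnitInterval.symm t := by
  ext i
  fin_cases i
  · simp [simplexEdge_coe]
    rfl
  · simp [simplexEdge_coe]
    rfl

lemma map_simplexEdge {m n : ℕ} (f : Fin m → Fin n) (i j : Fin m) (t : I) :
    stdSimplex.map f (simplexEdge i j t) = simplexEdge (f i) (f j) t := by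
  ext k
  simp [stdSimplex.map_coe, simplexEdge_coe, FunOnFinite.linearMap_piSingle]

/-- The path traced by a singular `1`-simplex. -/
def edgePath (s : C(stdSimplex ℝ (Fin 2), Y)) :
    Path (s (stdSimplex.vertex 0)) (s (stdSimplex.vertex 1)) :=
  (simplexEdge 0 1).map s.continuous

/-- The singular `1`-simplex that traces a path. -/
def pathSimplex {x y : Y} (p : Path x y) : C(stdSimplex ℝ (Fin 2), Y) :=
  p.toContinuousMap.comp (toContinuousMap stdSimplexHomeomorphUnitInterval)

lemma pathSimplex_simplexEdge {x y : Y} (p : Path x y) (t : I) :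
    pathSimplex p (simplexEdge 0 1 t) = p t := by
  simp [pathSimplex, simplexEdge_zero_one]

lemma simplexEdge_surjective (z : stdSimplex ℝ (Fin 2)) : ∃ t, simplexEdge 0 1 t = z :=
  ⟨stdSimplexHomeomorphUnitInterval z, by simp [simplexEdge_zero_one]⟩

lemma pathSimplex_edgePath (s : C(stdSimplex ℝ (Fin 2), Y)) : pathSimplex (edgePath s) = s := by
  ext z
  obtain ⟨t, rfl⟩ := simplexEdge_surjective z
  exact pathSimplex_simplexEdge _ t

lemma eq_pathSimplex_iff {x y : Y} {p : Path x y} {s : C(stdSimplex ℝ (Fin 2), Y)} :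
    s = pathSimplex p ↔ ∀ t, s (simplexEdge 0 1 t) = p t := by
  refine ⟨fun h t => h ▸ pathSimplex_simplexEdge p t, fun h => ?_⟩
  ext z
  obtain ⟨t, rfl⟩ := simplexEdge_surjective z
  rw [h, pathSimplex_simplexEdge]

end SimplexPaths

/-! ### Singular chains as free modules on simplices -/

section Chains

open CategoryTheory Simplicial Opposite unitInterval

variable (Y : Type) [TopologicalSpace Y]

/-- The singular chain complex with integer coefficients. -/
abbrev singularChains : ChainComplex (ModuleCat.{0} ℤ) ℕ :=
  (TopCat.toSSet.obj (TopCat.of Y)).chainComplex (ModuleCat.of ℤ ℤ)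

variable {Y}

/-- A singular simplex as a singular chain. -/
def simplexChain {n : ℕ} (f : C(stdSimplex ℝ (Fin (n + 1)), Y)) : (singularChains Y).X n :=
  ((TopCat.toSSet.obj (TopCat.of Y)).ιChainComplex (R := ModuleCat.of ℤ ℤ)
    ((TopCat.toSSetObjEquiv (TopCat.of Y) (op ⦋n⦌)).symm f)).hom (1 : ℤ)

/-- The `i`-th face of a singular simplex. -/
def simplexFace {n : ℕ} (i : Fin (n + 2)) (f : C(stdSimplex ℝ (Fin (n + 2)), Y)) :
    C(stdSimplex ℝ (Fin (n + 1)), Y) :=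
  f.comp ⟨stdSimplex.map i.succAbove, stdSimplex.continuous_map _⟩

lemma d_simplexChain {n : ℕ} (f : C(stdSimplex ℝ (Fin (n + 2)), Y)) :
    ((singularChains Y).d (n + 1) n).hom (simplexChain f) =
      ∑ i : Fin (n + 2), (-1 : ℤ) ^ i.val • simplexChain (simplexFace i f) := by
  have h := SSet.ιChainComplex_d (X := TopCat.toSSet.obj (TopCat.of Y)) (R := ModuleCat.of ℤ ℤ)
    ((TopCat.toSSetObjEquiv (TopCat.of Y) (op ⦋n + 1⦌)).symm f)
  have h2 := congrArg (fun φ => φ.hom (1 : ℤ)) h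
  refine h2.trans ?_
  simp only [ModuleCat.hom_sum, LinearMap.sum_apply, ModuleCat.hom_zsmul]
  rfl

lemma singularChains_hom_ext {n : ℕ} {A : Type} [AddCommGroup A]
    {φ ψ : (singularChains Y).X n →ₗ[ℤ] A}
    (h : ∀ f : C(stdSimplex ℝ (Fin (n + 1)), Y), φ (simplexChain f) = ψ (simplexChain f)) :
    φ = ψ := by
  suffices ModuleCat.ofHom φ = ModuleCat.ofHom ψ from congrArg ModuleCat.Hom.hom this
  refine SSet.chainComplex_hom_ext fun x => ?_
  obtain ⟨f, rfl⟩ := (TopCat.toSSetObjEquiv (TopCat.of Y) (op ⦋n⦌)).symm.surjective x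
  ext
  exact h f

lemma singularChains_addHom_ext {n : ℕ} {A : Type} [AddCommGroup A]
    {φ ψ : (singularChains Y).X n →+ A}
    (h : ∀ f : C(stdSimplex ℝ (Fin (n + 1)), Y), φ (simplexChain f) = ψ (simplexChain f)) :
    φ = ψ := by
  let toLin (θ : (singularChains Y).X n →+ A) : (singularChains Y).X n →ₗ[ℤ] A :=
    { θ with map_smul' := fun c x => by simpa using map_intCast_smul θ ℤ ℤ c x }
  have := singularChains_hom_ext (φ := toLin φ) (ψ := toLin ψ) h
  ext x
  exact LinearMap.congr_fun this x

lemma exists_singularChains_hom {n : ℕ} {A : Type} [AddCommGroup A]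
    (F : C(stdSimplex ℝ (Fin (n + 1)), Y) → A) :
    ∃ φ : (singularChains Y).X n →ₗ[ℤ] A, ∀ f, φ (simplexChain f) = F f := by
  let e := TopCat.toSSetObjEquiv (TopCat.of Y) (op ⦋n⦌)
  let S := TopCat.toSSet.obj (TopCat.of Y)
  let ψ := Limits.Cofan.IsColimit.desc (S.isColimitChainComplexXCofan (ModuleCat.of ℤ ℤ) n)
    (fun x => (ModuleCat.ofHom (LinearMap.toSpanSingleton ℤ A (F (e x))) :
      ModuleCat.of ℤ ℤ ⟶ ModuleCat.of ℤ A))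
  refine ⟨ψ.hom, fun f => ?_⟩
  have h : S.ιChainComplex (e.symm f) ≫ ψ = _ := Limits.Cofan.IsColimit.fac
    (S.isColimitChainComplexXCofan (ModuleCat.of ℤ ℤ) n) _ (e.symm f)
  have h2 := congrArg (fun φ => φ.hom (1 : ℤ)) h
  refine h2.trans ?_
  simp

end Chains

open CategoryTheory in
/-- The homology of a short complex of modules, computed by a map out of its middle term. -/
lemma ShortComplex.nonempty_homology_linearEquiv {R : Type} [Ring R]
    (S : ShortComplex (ModuleCat.{0} R)) {A : Type}
    [AddCommGroup A] [Module R A] (φ : S.X₂ →ₗ[R] A) (hf : ∀ x, φ (S.f.hom x) = 0)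
    (hsurj : ∀ a, ∃ x, S.g.hom x = 0 ∧ φ x = a)
    (hker : ∀ x, S.g.hom x = 0 → φ x = 0 → x ∈ LinearMap.range S.f.hom) :
    Nonempty (S.homology ≃ₗ[R] A) := by
  let ψ := φ.domRestrict (LinearMap.ker S.g.hom)
  have hψ : Function.Surjective ψ := fun a => by
    obtain ⟨x, hx, rfl⟩ := hsurj a
    exact ⟨⟨x, hx⟩, rfl⟩
  have hr : LinearMap.range S.moduleCatToCycles = LinearMap.ker ψ := by
    ext x
    constructor
    · rintro ⟨y, rfl⟩
      exact hf y
    · intro hx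
      obtain ⟨y, hy⟩ := hker x.1 x.2 hx
      exact ⟨y, Subtype.ext hy⟩
  exact ⟨(S.moduleCatHomologyIso.toLinearEquiv.trans
    ((Submodule.quotEquivOfEq _ _ hr).trans (ψ.quotKerEquivOfSurjective hψ)))⟩

end

/-! ### The Hurewicz theorem in degree one -/

noncomputable section

section Hurewicz

open unitInterval

variable {Y : Type} [TopologicalSpace Y]

variable (Y) in
/-- The singular `1`-chains modulo boundaries. -/
abbrev OneChainsModBoundaries : Type :=
  (singularChains Y).X 1 ⧸ LinearMap.range ((singularChains Y).d 2 1).hom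

/-- The class of a path among the singular `1`-chains modulo boundaries. -/
def pathClass {x y : Y} (p : Path x y) : OneChainsModBoundaries Y :=
  Submodule.Quotient.mk (simplexChain (pathSimplex p))

lemma simplexFace_eq_pathSimplex (F : C(stdSimplex ℝ (Fin 3), Y)) {i j k : Fin 3}
    (hj : i.succAbove 0 = j) (hk : i.succAbove 1 = k) {x y : Y} {p : Path x y}
    (hp : ∀ t, F (simplexEdge j k t) = p t) : simplexFace i F = pathSimplex p := by
  subst hj hk
  refine eq_pathSimplex_iff.2 fun t => ?_
  rw [← hp, ← map_simplexEdge i.succAbove]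
  rfl

lemma d_triangle (F : C(stdSimplex ℝ (Fin 3), Y)) {x y z : Y} {p : Path x y} {q : Path y z}
    {r : Path x z} (hp : ∀ t, F (simplexEdge 0 1 t) = p t)
    (hq : ∀ t, F (simplexEdge 1 2 t) = q t) (hr : ∀ t, F (simplexEdge 0 2 t) = r t) :
    ((singularChains Y).d 2 1).hom (simplexChain F) =
      simplexChain (pathSimplex q) - simplexChain (pathSimplex r)
        + simplexChain (pathSimplex p) := by
  have h := d_simplexChain F
  rw [Fin.sum_univ_three, simplexFace_eq_pathSimplex F (by decide) (by decide) hq,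
    simplexFace_eq_pathSimplex F (by decide) (by decide) hr,
    simplexFace_eq_pathSimplex F (by decide) (by decide) hp] at h
  refine h.trans ?_
  simp [sub_eq_add_neg]

lemma pathClass_triangle (F : C(stdSimplex ℝ (Fin 3), Y)) {x y z : Y} {p : Path x y}
    {q : Path y z} {r : Path x z} (hp : ∀ t, F (simplexEdge 0 1 t) = p t)
    (hq : ∀ t, F (simplexEdge 1 2 t) = q t) (hr : ∀ t, F (simplexEdge 0 2 t) = r t) :
    pathClass r = pathClass p + pathClass q := by
  unfold pathClass
  rw [← Submodule.Quotient.mk_add, eq_comm, Submodule.Quotient.eq]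
  refine ⟨simplexChain F, (d_triangle F hp hq hr).trans ?_⟩
  abel

/-- A constant 2-simplex has three equal edges, so the class `c` satisfies `c = c + c`. -/
lemma pathClass_refl (x : Y) : pathClass (Path.refl x) = 0 := by
  have h := pathClass_triangle (ContinuousMap.const _ x) (p := Path.refl x) (q := Path.refl x)
    (r := Path.refl x) (fun _ => rfl) (fun _ => rfl) (fun _ => rfl)
  simpa using h

lemma pathClass_trans {x y z : Y} (p : Path x y) (q : Path y z) :
    pathClass (p.trans q) = pathClass p + pathClass q := by
  have hmem (s : stdSimplex ℝ (Fin 3)) : s 1 / 2 + s 2 ∈ I := by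
    have h := stdSimplex.sum_eq_one s
    rw [Fin.sum_univ_three] at h
    have h0 := s.2.1 0
    have h1 := s.2.1 1
    have h2 := s.2.1 2
    change 0 ≤ s 0 at h0
    change 0 ≤ s 1 at h1
    change 0 ≤ s 2 at h2
    constructor <;> linarith
  have hc (i : Fin 3) : Continuous fun s : stdSimplex ℝ (Fin 3) => s i :=
    (continuous_apply i).comp continuous_subtype_val
  have h1 := hc 1
  have h2 := hc 2
  -- The affine map `s ↦ s 1 / 2 + s 2` collapses the triangle to the interval, sending the vertices
  -- to `0`, `1/2`, `1`; its edges trace `p`, `q` and `p.trans q`.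
  have hF : Continuous fun s : stdSimplex ℝ (Fin 3) => p.trans q ⟨s 1 / 2 + s 2, hmem s⟩ :=
    (p.trans q).continuous.comp (((h1.div_const 2).add h2).subtype_mk _)
  refine pathClass_triangle ⟨_, hF⟩ (fun t => ?_) (fun t => ?_) (fun t => ?_)
  · have ht : (t : ℝ) / 2 ≤ 2⁻¹ := by linarith [t.2.2]
    simp [simplexEdge_coe, Path.trans_apply, ht, mul_div_cancel₀]
  -- At `t = 0` the parameter is exactly `1/2`, which `Path.trans` assigns to its first branch.
  · by_cases ht : (t : ℝ) = 0
    · obtain rfl : t = 0 := Subtype.ext ht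
      simp [Path.trans_apply]
    · have h0 : 0 < (t : ℝ) := lt_of_le_of_ne t.2.1 (Ne.symm ht)
      have ht : ¬ (1 - (t : ℝ)) / 2 + t ≤ 1 / 2 := by linarith
      simp only [ContinuousMap.coe_mk, simplexEdge_coe, Path.trans_apply]
      simp only [Pi.add_apply, Pi.smul_apply, Pi.single_eq_same, smul_eq_mul, mul_one,
        ne_eq, Fin.reduceEq, not_false_eq_true, Pi.single_eq_of_ne, mul_zero, add_zero, zero_add,
        ht, dite_false]
      congr 1
      ext
      simp
      ring
  · simp [simplexEdge_coe]

lemma pathClass_eq_of_homotopy {x y : Y} {p q : Path x y} (H : p.Homotopy q) :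
    pathClass p = pathClass q := by
  have hmem (s : stdSimplex ℝ (Fin 3)) : s 1 + s 2 ∈ I := by
    have h := stdSimplex.sum_eq_one s
    rw [Fin.sum_univ_three] at h
    have h0 : 0 ≤ s 0 := s.2.1 0
    have h1 : 0 ≤ s 1 := s.2.1 1
    have h2 : 0 ≤ s 2 := s.2.1 2
    constructor <;> linarith
  have hmem2 (s : stdSimplex ℝ (Fin 3)) : s 2 ∈ I := ⟨s.2.1 2, stdSimplex.le_one s 2⟩
  have hc (i : Fin 3) : Continuous fun s : stdSimplex ℝ (Fin 3) => s i :=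
    (continuous_apply i).comp continuous_subtype_val
  have h1 := hc 1
  have h2 := hc 2
  -- The diagonal cuts the square of the homotopy into two triangles. Each has `r` as its long edge;
  -- the other two edges are a constant path and one of `p`, `q`.
  let r : Path x y := ⟨⟨fun t => H (t, t), by fun_prop⟩, by simp, by simp⟩
  have hr1 : pathClass r = pathClass p + pathClass (Path.refl y) := by
    refine pathClass_triangle ⟨fun s => H (⟨s 2, hmem2 s⟩, ⟨s 1 + s 2, hmem s⟩),
      H.continuous.comp ((h2.subtype_mk _).prodMk ((h1.add h2).subtype_mk _))⟩
      (fun t => ?_) (fun t => ?_) (fun t => ?_)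
    · simp [simplexEdge_coe]
    · simp [simplexEdge_coe]
    · simp [simplexEdge_coe, r]
  have hr2 : pathClass r = pathClass (Path.refl x) + pathClass q := by
    refine pathClass_triangle ⟨fun s => H (⟨s 1 + s 2, hmem s⟩, ⟨s 2, hmem2 s⟩),
      H.continuous.comp (((h1.add h2).subtype_mk _).prodMk (h2.subtype_mk _))⟩
      (fun t => ?_) (fun t => ?_) (fun t => ?_)
    · simp [simplexEdge_coe]
    · simp [simplexEdge_coe]
    · simp [simplexEdge_coe, r]
  rw [pathClass_refl] at hr1 hr2
  rw [← add_zero (pathClass p), ← hr1, hr2, zero_add]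

lemma pathClass_eq_of_homotopic {x y : Y} {p q : Path x y} (h : p.Homotopic q) :
    pathClass p = pathClass q :=
  h.elim pathClass_eq_of_homotopy

lemma pathClass_symm {x y : Y} (p : Path x y) : pathClass p.symm = -pathClass p := by
  rw [eq_neg_iff_add_eq_zero, ← pathClass_trans, ← pathClass_refl y]
  exact pathClass_eq_of_homotopic ⟨(Path.Homotopy.reflSymmTrans p).symm⟩

/-- The Hurewicz homomorphism, into the singular `1`-chains modulo boundaries. -/
def loopClassHom (x₀ : Y) : FundamentalGroup Y x₀ →*
    Multiplicative (OneChainsModBoundaries Y) where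
  toFun g := Multiplicative.ofAdd
    (Quotient.lift (fun p : Path x₀ x₀ => pathClass p) (fun _ _ => pathClass_eq_of_homotopic) g)
  map_one' := pathClass_refl x₀
  map_mul' a b := by
    induction a using Quotient.inductionOn with | _ p
    induction b using Quotient.inductionOn with | _ q
    -- The product `a * b` in the fundamental group is the class of `q` followed by `p`; the
    -- commutative target absorbs the reversal.
    refine (pathClass_trans q p).trans (add_comm _ _)

variable [PathConnectedSpace Y]

/-- The class in the abelianized fundamental group of the loop obtained from a path by joining its
endpoints to the base point. -/
def closedPathClass (x₀ : Y) {x y : Y} (p : Path x y) :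
    Additive (Abelianization (FundamentalGroup Y x₀)) :=
  Additive.ofMul (Abelianization.of (FundamentalGroup.fromPath
    (((Path.Homotopic.Quotient.mk (PathConnectedSpace.somePath x₀ x)).trans
      (Path.Homotopic.Quotient.mk p)).trans
      (Path.Homotopic.Quotient.mk (PathConnectedSpace.somePath x₀ y)).symm)))

lemma closedPathClass_congr (x₀ : Y) {x y : Y} {p q : Path x y} (h : p.Homotopic q) :
    closedPathClass x₀ p = closedPathClass x₀ q := by
  rw [closedPathClass, closedPathClass, Path.Homotopic.Quotient.eq.2 h]

/-- The chosen path to the middle point `y` is traversed once in each direction and cancels. -/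
lemma closedPathClass_trans (x₀ : Y) {x y z : Y} (p : Path x y) (q : Path y z) :
    closedPathClass x₀ (p.trans q) = closedPathClass x₀ p + closedPathClass x₀ q := by
  unfold closedPathClass
  rw [add_comm, ← ofMul_mul, ← map_mul]
  congr 2
  rw [FundamentalGroup.mul_def]
  simp [Path.Homotopic.Quotient.mk_trans, FundamentalGroup.fromPath, FundamentalGroup.fromArrow]
  congr 2
  rw [← Path.Homotopic.Quotient.trans_assoc, Path.Homotopic.Quotient.symm_trans,
    Path.Homotopic.Quotient.refl_trans]

lemma closedPathClass_loop (x₀ : Y) (p : Path x₀ x₀) :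
    closedPathClass x₀ p = Additive.ofMul (Abelianization.of (FundamentalGroup.fromPath
      (Path.Homotopic.Quotient.mk p))) := by
  let c : FundamentalGroup Y x₀ :=
    Path.Homotopic.Quotient.mk (PathConnectedSpace.somePath x₀ x₀)
  let g : FundamentalGroup Y x₀ := Path.Homotopic.Quotient.mk p
  change Additive.ofMul (Abelianization.of (c⁻¹ * (g * c))) = Additive.ofMul (Abelianization.of g)
  congr 1
  rw [map_mul, map_mul, map_inv, mul_comm, mul_inv_cancel_right]

lemma closedPathClass_eq {x₀ x y : Y} (p : Path x y) (s : C(stdSimplex ℝ (Fin 2), Y))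
    (h : ∀ t, s (simplexEdge 0 1 t) = p t) :
    closedPathClass x₀ (edgePath s) = closedPathClass x₀ p := by
  obtain rfl : s (stdSimplex.vertex 0) = x := by simpa using h 0
  obtain rfl : s (stdSimplex.vertex 1) = y := by simpa using h 1
  congr 1
  ext t
  exact h t

lemma closedPathClass_face (x₀ : Y) (F : C(stdSimplex ℝ (Fin 3), Y)) (i : Fin 3) {j k : Fin 3}
    (hj : i.succAbove 0 = j) (hk : i.succAbove 1 = k) :
    closedPathClass x₀ (edgePath (simplexFace i F)) =
      closedPathClass x₀ ((simplexEdge j k).map F.continuous) := by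
  subst hj hk
  refine closedPathClass_eq _ _ fun t => ?_
  change F (stdSimplex.map i.succAbove _) = F _
  rw [map_simplexEdge]

/-- The simplex is simply connected, so its long edge is homotopic to the other two edges in
succession. This is what makes `closedPathClass` vanish on boundaries. -/
lemma closedPathClass_triangle (x₀ : Y) (F : C(stdSimplex ℝ (Fin 3), Y)) :
    ∑ i : Fin 3, (-1 : ℤ) ^ i.val • closedPathClass x₀ (edgePath (simplexFace i F)) = 0 := by
  rw [Fin.sum_univ_three, closedPathClass_face x₀ F 0 (j := 1) (k := 2) (by decide) (by decide),
    closedPathClass_face x₀ F 1 (j := 0) (k := 2) (by decide) (by decide),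
    closedPathClass_face x₀ F 2 (j := 0) (k := 1) (by decide) (by decide),
    closedPathClass_congr x₀ ((SimplyConnectedSpace.paths_homotopic (simplexEdge 0 2)
      ((simplexEdge 0 1).trans (simplexEdge (1 : Fin 3) 2))).map F),
    Path.map_trans, closedPathClass_trans]
  simp

lemma loopClassHom_closedPath (x₀ : Y) {x y : Y} (p : Path x y) :
    (loopClassHom x₀ (FundamentalGroup.fromPath
    (((Path.Homotopic.Quotient.mk (PathConnectedSpace.somePath x₀ x)).trans
      (Path.Homotopic.Quotient.mk p)).trans
      (Path.Homotopic.Quotient.mk (PathConnectedSpace.somePath x₀ y)).symm))).toAdd =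
      pathClass (PathConnectedSpace.somePath x₀ x) + pathClass p
        - pathClass (PathConnectedSpace.somePath x₀ y) := by
  rw [← Path.Homotopic.Quotient.mk_trans, ← Path.Homotopic.Quotient.mk_symm,
    ← Path.Homotopic.Quotient.mk_trans, sub_eq_add_neg, ← pathClass_symm, ← pathClass_trans,
    ← pathClass_trans]
  rfl

variable (Y) in
/-- The first singular homology group of a path connected space is its abelianized fundamental
group. -/
theorem hurewicz_one (x₀ : Y) :
    Nonempty ((singularChains Y).homology 1 ≃+
      Additive (Abelianization (FundamentalGroup Y x₀))) := by
  obtain ⟨φ, hφ⟩ := exists_singularChains_hom (Y := Y) (n := 1)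
    fun s => closedPathClass x₀ (edgePath s)
  have hφp {x y : Y} (p : Path x y) : φ (simplexChain (pathSimplex p)) = closedPathClass x₀ p := by
    rw [hφ, closedPathClass_eq p _ fun t => pathSimplex_simplexEdge p t]
  let ψ : Additive (Abelianization (FundamentalGroup Y x₀)) →+ OneChainsModBoundaries Y :=
    MonoidHom.toAdditiveLeft (Abelianization.lift (loopClassHom x₀))
  obtain ⟨γ, hγ⟩ := exists_singularChains_hom (Y := Y) (n := 0) (A := OneChainsModBoundaries Y)
    fun s => pathClass (PathConnectedSpace.somePath x₀ (s (stdSimplex.vertex 0)))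
  have hγf (i : Fin 2) (s : C(stdSimplex ℝ (Fin 2), Y)) : γ (simplexChain (simplexFace i s)) =
      pathClass (PathConnectedSpace.somePath x₀ (s (stdSimplex.vertex (i.succAbove 0)))) := by
    rw [hγ]
    change pathClass (PathConnectedSpace.somePath x₀ (s (stdSimplex.map _ _))) = _
    rw [stdSimplex.map_vertex]
  -- Closing up a simplex adds the chosen path to its source and subtracts the one to its target;
  -- `γ` applied to the boundary undoes exactly this. On cycles the `γ` term is zero, so `ψ`
  -- recovers the class of a cycle from its image under `φ`, and `φ` is injective modulo boundaries.
  have key (c : (singularChains Y).X 1) : ψ (φ c) + γ (((singularChains Y).d 1 0).hom c) =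
      Submodule.Quotient.mk c := by
    suffices ψ.comp φ.toAddMonoidHom + (γ ∘ₗ ((singularChains Y).d 1 0).hom).toAddMonoidHom =
      (Submodule.mkQ (LinearMap.range ((singularChains Y).d 2 1).hom)).toAddMonoidHom
      from DFunLike.congr_fun this c
    refine singularChains_addHom_ext fun s => ?_
    change ψ (φ (simplexChain s)) + γ (((singularChains Y).d 1 0).hom (simplexChain s)) =
      Submodule.Quotient.mk (simplexChain s)
    have h1 : ψ (φ (simplexChain s)) =
        pathClass (PathConnectedSpace.somePath x₀ (s (stdSimplex.vertex 0))) +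
        pathClass (edgePath s) -
        pathClass (PathConnectedSpace.somePath x₀ (s (stdSimplex.vertex 1))) := by
      rw [hφ]
      exact loopClassHom_closedPath x₀ (edgePath s)
    have h2 : γ (((singularChains Y).d 1 0).hom (simplexChain s)) =
        pathClass (PathConnectedSpace.somePath x₀ (s (stdSimplex.vertex 1))) -
        pathClass (PathConnectedSpace.somePath x₀ (s (stdSimplex.vertex 0))) := by
      rw [d_simplexChain s, map_sum, Fin.sum_univ_two, map_zsmul, map_zsmul, hγf, hγf,
        show Fin.succAbove (0 : Fin 2) (0 : Fin 1) = 1 from rfl,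
        show Fin.succAbove (1 : Fin 2) (0 : Fin 1) = 0 from rfl]
      simp [sub_eq_add_neg]
    have h3 : Submodule.Quotient.mk (simplexChain s) = pathClass (edgePath s) := by
      rw [pathClass, pathSimplex_edgePath]
    rw [h1, h2, h3]
    abel
  have e := ShortComplex.nonempty_homology_linearEquiv ((singularChains Y).sc' 2 1 0) φ ?_ ?_ ?_
  · obtain ⟨e⟩ := e
    exact ⟨((CategoryTheory.ShortComplex.homologyMapIso
      ((singularChains Y).isoSc' 2 1 0 (by simp) (by simp))).toLinearEquiv.trans e).toAddEquiv⟩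
  · intro x
    have : φ ∘ₗ ((singularChains Y).d 2 1).hom = 0 := singularChains_hom_ext fun F => by
      change φ (((singularChains Y).d 2 1).hom (simplexChain F)) = 0
      rw [d_simplexChain F, map_sum, ← closedPathClass_triangle x₀ F]
      refine Finset.sum_congr rfl fun i _ => ?_
      rw [map_zsmul, hφ]
    exact LinearMap.congr_fun this x
  · intro a
    obtain ⟨g, rfl⟩ := (QuotientGroup.mk_surjective (s := commutator (FundamentalGroup Y x₀))) a
    induction g using Quotient.inductionOn with | _ p
    refine ⟨simplexChain (pathSimplex p), ?_, (hφp p).trans (closedPathClass_loop x₀ p)⟩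
    refine (d_simplexChain (pathSimplex p)).trans ?_
    have hf (i : Fin 2) : simplexFace i (pathSimplex p) = ContinuousMap.const _ x₀ := by
      ext z
      obtain rfl : z = stdSimplex.vertex 0 := Subsingleton.elim _ _
      change pathSimplex p (stdSimplex.map _ _) = x₀
      rw [stdSimplex.map_vertex]
      fin_cases i
      · exact ((pathSimplex p).congr_arg (simplexEdge 0 1).target.symm).trans
          ((pathSimplex_simplexEdge p 1).trans p.target)
      · exact ((pathSimplex p).congr_arg (simplexEdge 0 1).source.symm).trans
          ((pathSimplex_simplexEdge p 0).trans p.source)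
    rw [Fin.sum_univ_two, hf, hf]
    simp
    rfl
  · intro (x : (singularChains Y).X 1) (hx : ((singularChains Y).d 1 0).hom x = 0) (h0 : φ x = 0)
    have h := key x
    rw [h0, hx, map_zero, map_zero, add_zero] at h
    exact (Submodule.Quotient.mk_eq_zero _).1 h.symm

end Hurewicz

end

/-! ### Abelianization of the matrix groups -/

noncomputable section

/-- The abelianization of a semidirect product of abelian groups, computed by an invariant
homomorphism whose kernel consists of products of differences `φ h a / a`. -/
lemma SemidirectProduct.nonempty_abelianization_mulEquiv {A H T : Type} [CommGroup A] [CommGroup H]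
    [CommGroup T] (φ : H →* MulAut A) (f : A →* T) (hf : Function.Surjective f)
    (hinv : ∀ h a, f (φ h a) = f a)
    (hker : f.ker ≤ Subgroup.closure {x | ∃ h a, x = φ h a * a⁻¹}) :
    Nonempty (Abelianization (A ⋊[φ] H) ≃* T × H) := by
  let F : A ⋊[φ] H →* T × H :=
    { toFun := fun g => (f g.left, g.right)
      map_one' := by simp
      map_mul' := fun a b => by simp [hinv] }
  have hF : Function.Surjective F := fun ⟨t, h⟩ => by
    obtain ⟨a, rfl⟩ := hf t
    exact ⟨⟨a, h⟩, rfl⟩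
  have hcomm : commutator (A ⋊[φ] H) = F.ker := by
    refine le_antisymm (Abelianization.commutator_subset_ker F) fun g hg => ?_
    have h1 : f g.left = 1 := congrArg Prod.fst hg
    have h2 : g.right = 1 := congrArg Prod.snd hg
    have h3 : g = SemidirectProduct.inl g.left := by
      ext <;> simp [h2]
    -- In the semidirect product `φ h a * a⁻¹` is the commutator of `h` and `a`.
    have h4 : Subgroup.closure {x | ∃ h a, x = φ h a * a⁻¹} ≤
        (commutator (A ⋊[φ] H)).comap SemidirectProduct.inl := by
      rw [Subgroup.closure_le]
      rintro _ ⟨h, a, rfl⟩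
      change SemidirectProduct.inl (φ h a * a⁻¹) ∈ commutator (A ⋊[φ] H)
      rw [map_mul, SemidirectProduct.inl_aut, map_inv, map_inv, commutator_def]
      exact Subgroup.commutator_mem_commutator (Subgroup.mem_top _) (Subgroup.mem_top _)
    rw [h3]
    exact h4 (hker h1)
  exact ⟨(QuotientGroup.quotientMulEquivOfEq hcomm).trans
    (QuotientGroup.quotientKerEquivOfSurjective F hF)⟩

namespace OTManifold

open Matrix

/-- Reduction modulo the ideal `(w²)`. -/
def modSquare : (Fin 4 → ℤ) →+ ZMod 2 × ZMod 2 where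
  toFun x := (x 0, x 1)
  map_zero' := by simp
  map_add' x y := by simp

/-- Reduction modulo the prime ideal `(7, w + 2)`. -/
def modSeven : (Fin 4 → ℤ) →+ ZMod 7 where
  toFun x := x 0 - 2 * x 1 + 4 * x 2 - 8 * x 3
  map_zero' := by simp
  map_add' x y := by simp; ring

lemma M_mulVec (x : Fin 4 → ℤ) : (M : Matrix (Fin 4) (Fin 4) ℤ) *ᵥ x =
    ![-x 0 + 2 * x 2, -x 1 + 2 * x 3, x 0 - x 2, x 1 - x 3] := by
  ext i
  fin_cases i <;> simp [M, Matrix.mulVec, dotProduct, Fin.sum_univ_four] <;> ring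

lemma N_mulVec (x : Fin 4 → ℤ) : (N : Matrix (Fin 4) (Fin 4) ℤ) *ᵥ x =
    ![x 0 + 2 * x 3, x 0 + x 1, x 1 + x 2, x 2 + x 3] := by
  ext i
  fin_cases i <;> simp [N, Matrix.mulVec, dotProduct, Fin.sum_univ_four]

lemma N_sq_mulVec (x : Fin 4 → ℤ) : ((N ^ 2 : GL (Fin 4) ℤ) : Matrix (Fin 4) (Fin 4) ℤ) *ᵥ x =
    x + ![4 * x 3 + 2 * x 2, 2 * x 0 + 2 * x 3, 2 * x 1 + x 0, 2 * x 2 + x 1] := by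
  rw [pow_two, Units.val_mul, ← Matrix.mulVec_mulVec, N_mulVec, N_mulVec]
  ext i
  fin_cases i <;> simp <;> ring

/-- The invertible matrices that fix an additive functional. -/
def functionalStabilizer {T : Type} [AddCommGroup T] (f : (Fin 4 → ℤ) →+ T) :
    Subgroup (GL (Fin 4) ℤ) where
  carrier := {A | ∀ x, f ((A : Matrix (Fin 4) (Fin 4) ℤ) *ᵥ x) = f x}
  one_mem' x := by simp
  mul_mem' {A B} hA hB x := by
    rw [Units.val_mul, ← Matrix.mulVec_mulVec, hA, hB]
  inv_mem' {A} hA x := by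
    rw [← hA, Matrix.mulVec_mulVec, Units.mul_inv, Matrix.one_mulVec]

lemma functionalStabilizer_invariant {T : Type} [AddCommGroup T] {f : (Fin 4 → ℤ) →+ T} {a b : ℕ}
    (hM : M ^ a ∈ functionalStabilizer f) (hN : N ^ b ∈ functionalStabilizer f)
    (h : Multiplicative ℤ × Multiplicative ℤ) (x : Multiplicative (Fin 4 → ℤ)) :
    f (matrixAction a b h x).toAdd = f x.toAdd :=
  mul_mem (Subgroup.zpow_mem _ hM h.1.toAdd) (Subgroup.zpow_mem _ hN h.2.toAdd) x.toAdd

lemma zmod_two_two : (2 : ZMod 2) = 0 := rfl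
lemma zmod_seven_seven : (7 : ZMod 7) = 0 := rfl

/-- Here `u - 1 = w ^ 2 - 2` lies in `(w ^ 2)` because `2 = w ^ 4`. -/
lemma M_mem_stabilizer_modSquare : M ∈ functionalStabilizer modSquare := fun x => by
  rw [M_mulVec]
  simp [modSquare, zmod_two_two]

lemma N_sq_mem_stabilizer_modSquare : N ^ 2 ∈ functionalStabilizer modSquare := fun x => by
  rw [N_sq_mulVec, map_add]
  simp [modSquare, zmod_two_two, show (4 : ZMod 2) = 0 from rfl]

/-- Here `v ^ 2 - 1 = w (w + 2)` vanishes at `w = -2`. -/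
lemma N_sq_mem_stabilizer_modSeven : N ^ 2 ∈ functionalStabilizer modSeven := fun x => by
  rw [N_sq_mulVec, map_add]
  simp [modSeven]
  linear_combination (-2 * (x 2 : ZMod 7)) * zmod_seven_seven

/-- Substituting `w = -2` sends `u = w ^ 2 - 1` to `3`. -/
lemma modSeven_M_pow (m : ℕ) (x : Fin 4 → ℤ) :
    modSeven (((M ^ m : GL (Fin 4) ℤ) : Matrix (Fin 4) (Fin 4) ℤ) *ᵥ x) = 3 ^ m * modSeven x := by
  induction m with
  | zero => simp
  | succ m ih =>
    have h (y : Fin 4 → ℤ) : modSeven ((M : Matrix (Fin 4) (Fin 4) ℤ) *ᵥ y) = 3 * modSeven y := by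
      rw [M_mulVec]
      simp [modSeven]
      linear_combination (-2 * (y 2 : ZMod 7) + 4 * y 3) * zmod_seven_seven
    rw [pow_succ', Units.val_mul, ← Matrix.mulVec_mulVec, h, ih, pow_succ', mul_assoc]

lemma three_pow_eq_one_iff (m : ℕ) : (3 : ZMod 7) ^ m = 1 ↔ 6 ∣ m := by
  have h : orderOf (3 : ZMod 7) = 6 := (orderOf_eq_iff (by norm_num)).2 (by decide)
  rw [← orderOf_dvd_iff_pow_eq_one, h]

/-- The image of `N ^ 2 - 1` is the ideal `(v ^ 2 - 1)`, the intersection of `(w ^ 2)` and `(7, w +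
2)`; the two hypotheses are membership in these. -/
lemma exists_N_sq_sub (x : Fin 4 → ℤ) (h2 : modSquare x = 0) (h7 : modSeven x = 0) :
    ∃ y, ((N ^ 2 : GL (Fin 4) ℤ) : Matrix (Fin 4) (Fin 4) ℤ) *ᵥ y - y = x := by
  obtain ⟨a, ha⟩ := (ZMod.intCast_zmod_eq_zero_iff_dvd _ 2).1 (congrArg Prod.fst h2)
  obtain ⟨b, hb⟩ := (ZMod.intCast_zmod_eq_zero_iff_dvd _ 2).1 (congrArg Prod.snd h2)
  have h7' : ((x 0 - 2 * x 1 + 4 * x 2 - 8 * x 3 : ℤ) : ZMod 7) = 0 := by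
    push_cast
    exact h7
  obtain ⟨k, hk⟩ := (ZMod.intCast_zmod_eq_zero_iff_dvd _ 7).1 h7'
  push_cast at ha hb hk
  -- With last coordinate `t`, the first, second and fourth equations determine the other
  -- coordinates of `y`. The third then becomes `7 t = x 2 - 2 x 3 + 4 a - b`; four times the right
  -- side is `7 k + 14 a`.
  obtain ⟨t, ht⟩ : (7 : ℤ) ∣ x 2 - 2 * x 3 + 4 * a - b := by omega
  refine ⟨![b - t, x 3 - 2 * (a - 2 * t), a - 2 * t, t], ?_⟩
  rw [N_sq_mulVec, add_sub_cancel_left]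
  ext i
  fin_cases i
  · simp; linarith
  · simp; linarith
  · simp; linarith
  · simp

/-- The group `ℤ⁴ ⋊ ℤ²` in which `(s, t)` acts by `M^(a s) N^(b t)`. -/
abbrev MatrixGroup (a b : ℕ) : Type :=
  Multiplicative (Fin 4 → ℤ) ⋊[matrixAction a b] (Multiplicative ℤ × Multiplicative ℤ)

/-- Differences coming from the two generators of `ℤ²` already suffice to exhaust the kernel of `f`.
-/
lemma nonempty_abelianization_matrixGroup {T : Type} [AddCommGroup T] {a b : ℕ}
    (f : (Fin 4 → ℤ) →+ T) (hf : Function.Surjective f)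
    (hM : M ^ a ∈ functionalStabilizer f) (hN : N ^ b ∈ functionalStabilizer f)
    (hker : ∀ x, f x = 0 → ∃ y z,
      x = (((M ^ a : GL (Fin 4) ℤ) : Matrix (Fin 4) (Fin 4) ℤ) *ᵥ y - y) +
        (((N ^ b : GL (Fin 4) ℤ) : Matrix (Fin 4) (Fin 4) ℤ) *ᵥ z - z)) :
    Nonempty (Additive (Abelianization (MatrixGroup a b)) ≃+ T × (ℤ × ℤ)) := by
  have h := SemidirectProduct.nonempty_abelianization_mulEquiv
    (T := Multiplicative T) (matrixAction a b)
    (AddMonoidHom.toMultiplicative f) hf (functionalStabilizer_invariant (f := f) hM hN) ?_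
  · obtain ⟨e⟩ := h
    let e' : T × ℤ × ℤ ≃+ Additive (Multiplicative T × (Multiplicative ℤ × Multiplicative ℤ)) :=
      { toFun := fun x => Additive.ofMul (.ofAdd x.1, .ofAdd x.2.1, .ofAdd x.2.2)
        invFun := fun x => (x.toMul.1.toAdd, x.toMul.2.1.toAdd, x.toMul.2.2.toAdd)
        left_inv := fun _ => rfl
        right_inv := fun _ => rfl
        map_add' := fun _ _ => rfl }
    exact ⟨(MulEquiv.toAdditive e).trans e'.symm⟩
  · intro x hx
    obtain ⟨y, z, h⟩ := hker x.toAdd hx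
    have hx' : x = Multiplicative.ofAdd
          (((M ^ a : GL (Fin 4) ℤ) : Matrix (Fin 4) (Fin 4) ℤ) *ᵥ y - y) *
        Multiplicative.ofAdd
          (((N ^ b : GL (Fin 4) ℤ) : Matrix (Fin 4) (Fin 4) ℤ) *ᵥ z - z) := h
    rw [hx']
    refine mul_mem (Subgroup.subset_closure ⟨(.ofAdd 1, 1), .ofAdd y, ?_⟩)
      (Subgroup.subset_closure ⟨(1, .ofAdd 1), .ofAdd z, ?_⟩)
    · rw [sub_eq_add_neg, ofAdd_add]
      congr 1
      simp [matrixAction, mulVecAction]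
    · rw [sub_eq_add_neg, ofAdd_add]
      congr 1
      simp [matrixAction, mulVecAction]

lemma abelianization_of_not_dvd {m : ℕ} (hm : ¬ 6 ∣ m) :
    Nonempty (Additive (Abelianization (MatrixGroup m 2)) ≃+
      (ZMod 2 × ZMod 2) × (ℤ × ℤ)) := by
  refine nonempty_abelianization_matrixGroup modSquare ?_
    (pow_mem M_mem_stabilizer_modSquare m) N_sq_mem_stabilizer_modSquare fun x hx => ?_
  · rintro ⟨a, b⟩
    exact ⟨![a.val, b.val, 0, 0], by simp [modSquare]⟩
  · have : Fact (Nat.Prime 7) := ⟨by norm_num⟩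
    have h3 : (3 : ZMod 7) ^ m - 1 ≠ 0 := fun h => hm ((three_pow_eq_one_iff m).1 (sub_eq_zero.1 h))
    -- On `𝔽₇` the map `M ^ m - 1` is multiplication by the nonzero scalar `3 ^ m - 1`. This `y`
    -- makes `x - (M ^ m y - y)` vanish modulo `7`, leaving an element of the image of `N ^ 2 - 1`.
    let y : Fin 4 → ℤ := ![((modSeven x / (3 ^ m - 1) : ZMod 7).val : ℤ), 0, 0, 0]
    have hy : modSeven y = modSeven x / (3 ^ m - 1) := by simp [y, modSeven]
    obtain ⟨z, hz⟩ := exists_N_sq_sub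
      (x - (((M ^ m : GL (Fin 4) ℤ) : Matrix (Fin 4) (Fin 4) ℤ) *ᵥ y - y))
      (by rw [map_sub, map_sub, pow_mem M_mem_stabilizer_modSquare m y, hx]; simp)
      (by rw [map_sub, map_sub, modSeven_M_pow, hy]; field_simp; ring)
    exact ⟨y, z, by rw [hz]; abel⟩

lemma abelianization_of_dvd {m : ℕ} (hm : 6 ∣ m) :
    Nonempty (Additive (Abelianization (MatrixGroup m 2)) ≃+
      (ZMod 2 × ZMod 2) × ZMod 7 × (ℤ × ℤ)) := by
  have h := nonempty_abelianization_matrixGroup (a := m) (b := 2) (modSquare.prod modSeven) ?_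
    (fun x => Prod.ext (pow_mem M_mem_stabilizer_modSquare m x)
      (by
        change modSeven _ = modSeven _
        rw [modSeven_M_pow, (three_pow_eq_one_iff m).2 hm, one_mul]))
    (fun x => Prod.ext (N_sq_mem_stabilizer_modSquare x) (N_sq_mem_stabilizer_modSeven x))
    fun x hx => ?_
  · obtain ⟨e⟩ := h
    exact ⟨e.trans AddEquiv.prodAssoc⟩
  · rintro ⟨⟨a, b⟩, c⟩
    -- The factor `2` inverts the coefficient `4` of `x 2` modulo `7`.
    refine ⟨![a.val, b.val, 2 * (c - a.val + 2 * b.val : ZMod 7).val, 0], ?_⟩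
    refine Prod.ext (by simp [modSquare]) ?_
    simp [modSeven]
    linear_combination (c - a.cast + 2 * b.cast : ZMod 7) * zmod_seven_seven
  · obtain ⟨z, hz⟩ := exists_N_sq_sub x (congrArg Prod.fst hx) (congrArg Prod.snd hx)
    exact ⟨0, z, by rw [hz]; simp⟩

end OTManifold

end

/-! ### The ring of integers is `ℤ[w]` -/

noncomputable section

namespace OTManifold

open Polynomial

lemma X_pow_four_sub_two_isEisensteinAt :
    (Polynomial.X ^ 4 - C 2 : ℤ[X]).IsEisensteinAt (Submodule.span ℤ {2}) where
  leading := by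
    rw [leadingCoeff_X_pow_sub_C (by norm_num)]
    exact fun h => by
      have := Ideal.mem_span_singleton.1 h
      norm_num at this
  mem := fun {n} hn => by
    rw [natDegree_X_pow_sub_C] at hn
    rw [coeff_sub, coeff_X_pow, coeff_C, if_neg hn.ne]
    refine Ideal.mem_span_singleton.2 ?_
    split_ifs <;> simp
  notMem := by
    change _ ∉ (Ideal.span {2} : Ideal ℤ) ^ 2
    rw [Ideal.span_singleton_pow, Ideal.mem_span_singleton]
    simp [coeff_X_pow]

lemma monic_X_pow_four_sub_two : (Polynomial.X ^ 4 - C 2 : ℤ[X]).Monic :=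
  monic_X_pow_sub_C _ (by norm_num)

lemma minpoly_rat_wK : minpoly ℚ wK = Polynomial.X ^ 4 - C 2 := by
  have hp : Ideal.IsPrime (Submodule.span ℤ {(2 : ℤ)}) :=
    (Ideal.span_singleton_prime two_ne_zero).2 Int.prime_two
  have h1 := X_pow_four_sub_two_isEisensteinAt.irreducible hp
    monic_X_pow_four_sub_two.isPrimitive (by rw [natDegree_X_pow_sub_C]; norm_num)
  have h2 := (monic_X_pow_four_sub_two.irreducible_iff_irreducible_map_fraction_map (K := ℚ)).1 h1
  have h3 : (Polynomial.X ^ 4 - C 2 : ℤ[X]).map (algebraMap ℤ ℚ) = Polynomial.X ^ 4 - C 2 := by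
    rw [Polynomial.map_sub, Polynomial.map_pow, map_X, map_C, map_ofNat]
  rw [h3] at h2
  exact (minpoly.eq_of_irreducible_of_monic h2 (by simp [wK_pow_four])
    (monic_X_pow_sub_C _ (by norm_num))).symm

lemma minpoly_int_wK : minpoly ℤ wK = Polynomial.X ^ 4 - C 2 := by
  have h := minpoly.isIntegrallyClosed_eq_field_fractions' ℚ isIntegral_wK
  refine map_injective (algebraMap ℤ ℚ) (RingHom.injective_int _) ?_
  rw [← h, minpoly_rat_wK, Polynomial.map_sub, Polynomial.map_pow, map_X, map_C,
    map_ofNat (algebraMap ℤ ℚ)]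

/-- The power basis of `K` given by `wK`. -/
def powerBasis : PowerBasis ℚ K :=
  IntermediateField.adjoin.powerBasis (x := (2 : ℝ) ^ (1 / 4 : ℝ))
    ⟨Polynomial.X ^ 4 - C 2, monic_X_pow_sub_C _ (by norm_num), by
      rw [eval₂_sub, eval₂_X_pow, root_pow_four]
      simp⟩

lemma powerBasis_gen : powerBasis.gen = wK := rfl

instance : FiniteDimensional ℚ K := powerBasis.finite

lemma norm_wK : Algebra.norm ℚ wK = 2 ∨ Algebra.norm ℚ wK = -2 := by
  have h := Algebra.PowerBasis.norm_gen_eq_coeff_zero_minpoly powerBasis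
  rw [powerBasis_gen, minpoly_rat_wK] at h
  rcases neg_one_pow_eq_or ℚ powerBasis.dim with h1 | h1 <;> simp [h, h1, coeff_X_pow]

/-- Up to sign the discriminant is the norm of the derivative of the minimal polynomial at `w`, that
is, of `4 w ^ 3`. Signs are irrelevant, since only divisibility is needed later. -/
lemma exists_discr_powerBasis : ∃ n : ℕ,
    Algebra.discr ℚ powerBasis.basis = 2 ^ n ∨ Algebra.discr ℚ powerBasis.basis = -2 ^ n := by
  have h := Algebra.discr_powerBasis_eq_norm ℚ powerBasis
  have h4 : Algebra.norm ℚ (4 : K) = 4 ^ Module.finrank ℚ K := by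
    rw [← Algebra.norm_algebraMap]
    simp
  have hd : aeval wK (derivative (Polynomial.X ^ 4 - C 2 : ℚ[X])) = 4 * wK ^ 3 := by
    simp
    norm_num
  rw [powerBasis_gen, minpoly_rat_wK, hd, map_mul, map_pow, h4] at h
  refine ⟨2 * Module.finrank ℚ K + 3, ?_⟩
  rw [pow_add, pow_mul, h, show (2 : ℚ) ^ 2 = 4 by norm_num]
  rcases neg_one_pow_eq_or ℚ (Module.finrank ℚ K * (Module.finrank ℚ K - 1) / 2) with h1 | h1 <;>
  rcases norm_wK with h2 | h2 <;> rw [h1, h2] <;> [left; right; right; left] <;> ring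

/-- The discriminant multiplies `z` into `ℤ[w]`, so some power of `2` does; the Eisenstein property
at `2` removes that power. -/
lemma mem_adjoin_wK {z : K} (hz : IsIntegral ℤ z) : z ∈ Algebra.adjoin ℤ {wK} := by
  obtain ⟨n, hn⟩ := exists_discr_powerBasis
  have h := Algebra.discr_mul_isIntegral_mem_adjoin ℚ (B := powerBasis) isIntegral_wK hz
  have h2 : (2 : ℤ) ^ n • z ∈ Algebra.adjoin ℤ {powerBasis.gen} := by
    have hz2 : (2 : ℤ) ^ n • z = (2 : ℚ) ^ n • z := by
      rw [zsmul_eq_mul, Algebra.smul_def]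
      simp
    rcases hn with hn | hn
    · rwa [hz2, ← hn]
    · rw [hz2, ← neg_neg ((2 : ℚ) ^ n), ← hn, neg_smul]
      exact neg_mem h
  exact mem_adjoin_of_smul_prime_pow_smul_of_minpoly_isEisensteinAt (B := powerBasis)
    Int.prime_two isIntegral_wK hz h2
    (by rw [powerBasis_gen, minpoly_int_wK]; exact X_pow_four_sub_two_isEisensteinAt)

lemma algebraMap_w : algebraMap (𝓞 K) K w = wK := rfl

/-- The integral linear combination of the powers of `w` with given coefficients. -/
def coordHom : (Fin 4 → ℤ) →+ 𝓞 K where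
  toFun x := x 0 + x 1 * w + x 2 * w ^ 2 + x 3 * w ^ 3
  map_zero' := by simp
  map_add' x y := by simp; ring

lemma coordHom_apply (x : Fin 4 → ℤ) :
    coordHom x = x 0 + x 1 * w + x 2 * w ^ 2 + x 3 * w ^ 3 := rfl

lemma coordHom_injective : Function.Injective coordHom := by
  rw [injective_iff_map_eq_zero]
  intro x hx
  have hK : (x 0 + x 1 * wK + x 2 * wK ^ 2 + x 3 * wK ^ 3 : K) = 0 := by
    have := congrArg (algebraMap (𝓞 K) K) hx
    simpa [coordHom_apply, algebraMap_w] using this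
  let p : ℚ[X] := C (x 3 : ℚ) * Polynomial.X ^ 3 + C (x 2 : ℚ) * Polynomial.X ^ 2 + C (x 1 : ℚ) * Polynomial.X + C (x 0 : ℚ)
  have hp : p = 0 := by
    by_contra hp
    have h := minpoly.degree_le_of_ne_zero ℚ wK hp (by
      simp only [p, map_add, map_mul, aeval_C, aeval_X, map_pow]
      simp
      linear_combination hK)
    rw [minpoly_rat_wK, degree_X_pow_sub_C (by norm_num)] at h
    have h3 := h.trans degree_cubic_le
    norm_num at h3
  ext i
  have hc : p.coeff i = x i := by fin_cases i <;> simp [p, coeff_X, coeff_C, -map_intCast]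
  rw [hp] at hc
  simpa using hc.symm

lemma coordHom_surjective : Function.Surjective coordHom := by
  intro z
  have h (y : K) (hy : y ∈ Algebra.adjoin ℤ {wK}) : ∃ x, algebraMap (𝓞 K) K (coordHom x) = y := by
    induction hy using Algebra.adjoin_induction with
    | mem y hy =>
      obtain rfl := hy
      exact ⟨![0, 1, 0, 0], by simp [coordHom_apply, algebraMap_w]⟩
    | algebraMap r => exact ⟨![r, 0, 0, 0], by simp [coordHom_apply]⟩
    | add y z _ _ hy hz =>
      obtain ⟨a, rfl⟩ := hy
      obtain ⟨b, rfl⟩ := hz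
      exact ⟨a + b, by simp⟩
    | mul y z _ _ hy hz =>
      obtain ⟨a, rfl⟩ := hy
      obtain ⟨b, rfl⟩ := hz
      refine ⟨![a 0 * b 0 + 2 * (a 1 * b 3 + a 2 * b 2 + a 3 * b 1),
        a 0 * b 1 + a 1 * b 0 + 2 * (a 2 * b 3 + a 3 * b 2),
        a 0 * b 2 + a 1 * b 1 + a 2 * b 0 + 2 * (a 3 * b 3),
        a 0 * b 3 + a 1 * b 2 + a 2 * b 1 + a 3 * b 0], ?_⟩
      rw [← map_mul]
      congr 1
      simp [coordHom_apply]
      linear_combination (-(a 1 * b 3 + a 2 * b 2 + a 3 * b 1) - (a 2 * b 3 + a 3 * b 2) * w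
        - a 3 * b 3 * w ^ 2 : 𝓞 K) * w_pow_four
  obtain ⟨x, hx⟩ := h z (mem_adjoin_wK z.2)
  exact ⟨x, NumberField.RingOfIntegers.ext hx⟩

/-- The coordinates with respect to the integral basis `1, w, w², w³`. -/
def coordEquiv : (Fin 4 → ℤ) ≃+ 𝓞 K :=
  AddEquiv.ofBijective coordHom ⟨coordHom_injective, coordHom_surjective⟩

/-- The pairs of a matrix and a unit that act in the same way. -/
def intertwiningSubgroup : Subgroup (GL (Fin 4) ℤ × (𝓞 K)ˣ) where
  carrier := {p | ∀ x, coordEquiv ((p.1 : Matrix (Fin 4) (Fin 4) ℤ).mulVec x) =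
    (p.2 : 𝓞 K) * coordEquiv x}
  one_mem' x := by simp
  mul_mem' {p q} hp hq x := by
    simp only [Prod.fst_mul, Prod.snd_mul, Units.val_mul]
    rw [← Matrix.mulVec_mulVec, hp, hq, mul_assoc]
  inv_mem' {p} hp x := by
    have h := hp (((p.1⁻¹ : GL (Fin 4) ℤ) : Matrix (Fin 4) (Fin 4) ℤ).mulVec x)
    rw [Matrix.mulVec_mulVec, Units.mul_inv, Matrix.one_mulVec] at h
    simp only [Prod.fst_inv, Prod.snd_inv]
    rw [h, Units.inv_mul_cancel_left]

lemma M_u_mem : (M, u) ∈ intertwiningSubgroup := fun x => by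
  change coordHom ((M : Matrix (Fin 4) (Fin 4) ℤ).mulVec x) = (w ^ 2 - 1) * coordHom x
  rw [M_mulVec]
  simp [coordHom_apply]
  linear_combination (-x 2 - x 3 * w : 𝓞 K) * w_pow_four

lemma N_v_mem : (N, v) ∈ intertwiningSubgroup := fun x => by
  change coordHom ((N : Matrix (Fin 4) (Fin 4) ℤ).mulVec x) = (w + 1) * coordHom x
  rw [N_mulVec]
  simp [coordHom_apply]
  linear_combination (-x 3 : 𝓞 K) * w_pow_four

end OTManifold

end

/-! ### Embeddings of `K` and discreteness of the integers -/

noncomputable section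

namespace OTManifold

lemma u_coe : ((u : 𝓞 K) : K) = wK ^ 2 - 1 := rfl

lemma v_coe : ((v : 𝓞 K) : K) = wK + 1 := rfl

lemma map_wK_pow_four {A : Type} [Ring A] (σ : K →+* A) : σ wK ^ 4 = 2 := by
  rw [← map_pow, wK_pow_four, map_ofNat]

lemma ringHom_ext {A : Type} [Ring A] [Algebra ℚ A] {σ τ : K →+* A} (h : σ wK = τ wK) : σ = τ := by
  have := powerBasis.algHom_ext (f := σ.toRatAlgHom) (g := τ.toRatAlgHom) h
  exact RingHom.ext fun x => DFunLike.congr_fun this x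

lemma one_lt_map_wK_sq (σ : K →+* ℝ) : 1 < σ wK ^ 2 := by
  have h := map_wK_pow_four σ
  nlinarith [sq_nonneg (σ wK)]

lemma map_wK_neg {σ τ : K →+* ℝ} (h : σ ≠ τ) : τ wK = -σ wK := by
  have h1 := map_wK_pow_four σ
  have h2 := map_wK_pow_four τ
  have h3 : σ wK - τ wK ≠ 0 := fun h' => h (ringHom_ext (sub_eq_zero.1 h'))
  have h4 : (σ wK - τ wK) * ((σ wK + τ wK) * (σ wK ^ 2 + τ wK ^ 2)) = 0 := by
    linear_combination h1 - h2
  have h5 := (mul_eq_zero.1 h4).resolve_left h3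
  have h6 : σ wK ^ 2 + τ wK ^ 2 ≠ 0 := by
    have := one_lt_map_wK_sq σ
    positivity
  linarith [(mul_eq_zero.1 h5).resolve_right h6]

/-- Write `σ₃ w = x + i y` with `y ≠ 0`. The imaginary part of `(x + i y) ^ 4 = 2` forces `x = 0` or
`x ^ 2 = y ^ 2`, and in the second case the real part would be `-4 x ^ 4 ≤ 0`. -/
lemma map_wK_re_eq_zero {σ₃ : K →+* ℂ} (hσ₃ : ¬ NumberField.ComplexEmbedding.IsReal σ₃) :
    (σ₃ wK).re = 0 := by
  have him : (σ₃ wK).im ≠ 0 := fun h => hσ₃ <| by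
    rw [NumberField.ComplexEmbedding.isReal_iff]
    refine ringHom_ext ?_
    rw [NumberField.ComplexEmbedding.conjugate_coe_eq]
    exact Complex.conj_eq_iff_im.2 h
  have h := congrArg Complex.im (map_wK_pow_four σ₃)
  have h' := congrArg Complex.re (map_wK_pow_four σ₃)
  simp [pow_succ] at h h'
  set x := (σ₃ wK).re
  set y := (σ₃ wK).im
  have h2 : (4 * y) * (x * (x ^ 2 - y ^ 2)) = 0 := by linear_combination h
  rcases mul_eq_zero.1 ((mul_eq_zero.1 h2).resolve_left (by simpa using him)) with h3 | h3
  · exact h3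
  · have : x ^ 2 = y ^ 2 := by linarith
    nlinarith [sq_nonneg (x * y), sq_nonneg x]

lemma map_wK_im_sq {σ₃ : K →+* ℂ} (hσ₃ : ¬ NumberField.ComplexEmbedding.IsReal σ₃)
    (σ : K →+* ℝ) : (σ₃ wK).im ^ 2 = σ wK ^ 2 := by
  have h := congrArg Complex.re (map_wK_pow_four σ₃)
  simp [pow_succ, map_wK_re_eq_zero hσ₃] at h
  have h' := map_wK_pow_four σ
  nlinarith [sq_nonneg (σ₃ wK).im, one_lt_map_wK_sq σ]

lemma int_eq_zero_of_abs_lt {a c : ℝ} (ha : 1 ≤ a) {n : ℤ} (h : a * n = c) (hc : |c| < 1) :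
    n = 0 := by
  have h1 : |(n : ℝ)| < 1 := by
    refine lt_of_le_of_lt ?_ hc
    rw [← h, abs_mul, abs_of_nonneg (zero_le_one.trans ha)]
    exact le_mul_of_one_le_left (abs_nonneg _) ha
  exact Int.abs_lt_one_iff.1 (by exact_mod_cast h1)

lemma abs_lt_one_of_abs_mul_lt {a b : ℝ} (ha : 1 < a ^ 2) (h : |a * b| < 1) : |b| < 1 := by
  have h1 : 1 ≤ |a| := by
    rw [← sq_abs] at ha
    exact (one_lt_sq_iff₀ (abs_nonneg a)).1 ha |>.le
  rw [abs_mul] at h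
  exact (le_mul_of_one_le_left (abs_nonneg b) h1).trans_lt h

/-- An algebraic integer all of whose conjugates are small vanishes. -/
lemma eq_zero_of_map_small {σ₁ σ₂ : K →+* ℝ} (hσ : σ₁ ≠ σ₂) {σ₃ : K →+* ℂ}
    (hσ₃ : ¬ NumberField.ComplexEmbedding.IsReal σ₃) (h : 𝓞 K) (h₁ : |σ₁ (h : K)| < 1)
    (h₂ : |σ₂ (h : K)| < 1) (h₃ : ‖σ₃ (h : K)‖ < 1) : h = 0 := by
  obtain ⟨x, rfl⟩ := coordEquiv.surjective h
  have hx : ((coordEquiv x : 𝓞 K) : K) =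
      x 0 + x 1 * wK + x 2 * wK ^ 2 + x 3 * wK ^ 3 := by
    change algebraMap (𝓞 K) K (coordHom x) = _
    simp [coordHom_apply, algebraMap_w]
  set s := σ₁ wK with hs
  set y := (σ₃ wK).im with hy
  have hs2 := one_lt_map_wK_sq σ₁
  have hys : y ^ 2 = s ^ 2 := map_wK_im_sq hσ₃ σ₁
  have h3w : σ₃ wK = y * Complex.I := by
    apply Complex.ext <;> simp [map_wK_re_eq_zero hσ₃, hy]
  rw [hx] at h₁ h₂ h₃
  simp only [map_add, map_mul, map_pow, map_intCast, map_wK_neg hσ, ← hs] at h₁ h₂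
  have h3re := (Complex.abs_re_le_norm _).trans_lt h₃
  have h3im := (Complex.abs_im_le_norm _).trans_lt h₃
  -- The conjugates of `w` are `s`, `-s` and `± i y` with `y ^ 2 = s ^ 2`. Half sums and half
  -- differences of the two real conjugates, and the real and imaginary parts of the complex one,
  -- therefore bound `x 0 ± s ^ 2 * x 2` and `x 1 ± s ^ 2 * x 3` by `1`.
  have hD : |y * (x 1 - s ^ 2 * x 3)| < 1 := by
    suffices (σ₃ (x 0 + x 1 * wK + x 2 * wK ^ 2 + x 3 * wK ^ 3)).im = y * (x 1 - s ^ 2 * x 3) from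
      this ▸ h3im
    simp [h3w, pow_succ]
    linear_combination (-(y * x 3)) * hys
  have hC : |(x 0 : ℝ) - s ^ 2 * x 2| < 1 := by
    suffices (σ₃ (x 0 + x 1 * wK + x 2 * wK ^ 2 + x 3 * wK ^ 3)).re = x 0 - s ^ 2 * x 2 from
      this ▸ h3re
    simp [h3w, pow_succ]
    linear_combination (-(x 2) : ℝ) * hys
  have hD' := abs_lt.1 (abs_lt_one_of_abs_mul_lt (hys ▸ hs2) hD)
  have hE : |s * (x 1 + s ^ 2 * x 3)| < 1 := by
    rw [abs_lt] at h₁ h₂ ⊢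
    constructor <;> linarith
  have hE' := abs_lt.1 (abs_lt_one_of_abs_mul_lt hs2 hE)
  rw [abs_lt] at h₁ h₂ hC
  -- Averaging each pair of bounds isolates one coordinate, possibly with the factor `s ^ 2 > 1`.
  have e0 : x 0 = 0 := int_eq_zero_of_abs_lt (a := 1) le_rfl rfl
    (abs_lt.2 ⟨by linarith, by linarith⟩)
  have e1 : x 1 = 0 := int_eq_zero_of_abs_lt (a := 1) le_rfl rfl
    (abs_lt.2 ⟨by linarith, by linarith⟩)
  have e2 : x 2 = 0 := int_eq_zero_of_abs_lt hs2.le rfl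
    (abs_lt.2 ⟨by linarith, by linarith⟩)
  have e3 : x 3 = 0 := int_eq_zero_of_abs_lt hs2.le rfl
    (abs_lt.2 ⟨by linarith, by linarith⟩)
  have : x = 0 := by
    ext i
    fin_cases i <;> assumption
  rw [this, map_zero]

end OTManifold

end

/-! ### The unit group and the passage to matrices -/

noncomputable section

namespace OTManifold

open Classical in
lemma signExponent_u : signExponent u = 1 := by
  refine (Nat.find_eq_iff _).2 ⟨⟨one_pos, fun σ => ?_⟩, fun n hn h => ?_⟩
  · rw [pow_one, u_coe, map_sub, map_pow, map_one]
    linarith [one_lt_map_wK_sq σ]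
  · omega

open Classical in
-- If `σ w < 0` then `σ w < -1`, so `v = w + 1` is negative there, while its square is totally
-- positive.
lemma signExponent_v {σ : K →+* ℝ} (hσ : σ wK < 0) : signExponent v = 2 := by
  refine (Nat.find_eq_iff _).2 ⟨⟨two_pos, fun τ => ?_⟩, fun n hn h => ?_⟩
  · have h1 : ((v : 𝓞 K) : K) ≠ 0 := by
      rw [ne_eq, NumberField.RingOfIntegers.coe_eq_zero_iff]
      exact v.ne_zero
    have h2 : (((v ^ 2 : (𝓞 K)ˣ) : 𝓞 K) : K) = ((v : 𝓞 K) : K) ^ 2 := by simp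
    rw [h2, map_pow]
    have := (map_ne_zero τ).2 h1
    positivity
  · obtain rfl : n = 1 := by omega
    have h1 := h.2 σ
    rw [pow_one, v_coe, map_add, map_one] at h1
    nlinarith [one_lt_map_wK_sq σ]

lemma signExponent_v_of_ne {σ₁ σ₂ : K →+* ℝ} (hσ : σ₁ ≠ σ₂) : signExponent v = 2 := by
  rcases lt_trichotomy (σ₁ wK) 0 with h | h | h
  · exact signExponent_v h
  · have := one_lt_map_wK_sq σ₁
    rw [h] at this
    norm_num at this
  · exact signExponent_v (σ := σ₂) (by rw [map_wK_neg hσ]; linarith)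

/-- The parametrization of the unit group `U_{m,1}` by `ℤ²`. -/
def unitHom (m : ℕ) : Multiplicative ℤ × Multiplicative ℤ →* unitGroup m 1 :=
  MonoidHom.coprod
    (zpowersHom _ ⟨positivePower u ^ m, Subgroup.subset_closure (by simp)⟩)
    (zpowersHom _ ⟨positivePower v ^ 1, Subgroup.subset_closure (by simp)⟩)

lemma unitHom_surjective (m : ℕ) : Function.Surjective (unitHom m) := by
  rintro ⟨k, hk⟩
  obtain ⟨a, b, rfl⟩ := Subgroup.mem_closure_pair.1 hk
  exact ⟨(.ofAdd a, .ofAdd b), rfl⟩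

lemma unitHom_coe {σ₁ σ₂ : K →+* ℝ} (hσ : σ₁ ≠ σ₂) (m : ℕ)
    (g : Multiplicative ℤ × Multiplicative ℤ) :
    ((unitHom m g : totallyPositiveUnits K) : (𝓞 K)ˣ) =
      (u ^ m) ^ g.1.toAdd * (v ^ 2) ^ g.2.toAdd := by
  have h1 : ((positivePower u : totallyPositiveUnits K) : (𝓞 K)ˣ) = u :=
    (congrArg (u ^ ·) signExponent_u).trans (pow_one u)
  have h2 : ((positivePower v : totallyPositiveUnits K) : (𝓞 K)ˣ) = v ^ 2 :=
    congrArg (v ^ ·) (signExponent_v_of_ne hσ)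
  simp [unitHom, h1, h2]

/-- Although `σ w + 1` may be negative, the formula holds because `Real.log` depends only on the
absolute value. -/
lemma log_map_unitHom {σ₁ σ₂ : K →+* ℝ} (hσ : σ₁ ≠ σ₂) (m : ℕ)
    (g : Multiplicative ℤ × Multiplicative ℤ) (σ : K →+* ℝ) :
    Real.log (σ ((((unitHom m g : totallyPositiveUnits K) : (𝓞 K)ˣ) : 𝓞 K) : K)) =
      g.1.toAdd * m * Real.log (σ wK ^ 2 - 1) + g.2.toAdd * 2 * Real.log (σ wK + 1) := by
  have h : ((((u ^ m) ^ g.1.toAdd * (v ^ 2) ^ g.2.toAdd : (𝓞 K)ˣ) : 𝓞 K) : K) =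
      ((((u : 𝓞 K) : K) ^ m) ^ g.1.toAdd) * ((((v : 𝓞 K) : K) ^ 2) ^ g.2.toAdd) := by
    have hc (x : (𝓞 K)ˣ) : ((x : 𝓞 K) : K) = algebraMap (𝓞 K) K x := rfl
    rw [hc, NumberField.Units.coe_mul, NumberField.Units.coe_zpow, NumberField.Units.coe_zpow,
      NumberField.Units.coe_pow, NumberField.Units.coe_pow]
  have hu : σ wK ^ 2 - 1 ≠ 0 := by linarith [one_lt_map_wK_sq σ]
  have hv : σ wK + 1 ≠ 0 := fun h => hu (by linear_combination (σ wK - 1) * h)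
  rw [unitHom_coe hσ, h, u_coe, v_coe]
  simp only [map_mul, map_zpow₀, map_pow, map_sub, map_add, map_one]
  rw [Real.log_mul (zpow_ne_zero _ (pow_ne_zero _ hu)) (zpow_ne_zero _ (pow_ne_zero _ hv)),
    Real.log_zpow, Real.log_zpow, Real.log_pow, Real.log_pow]
  push_cast
  ring

/-- The units of `U_{m,1}` are discrete in the logarithmic embedding. -/
lemma exists_forall_abs_log_lt {σ₁ σ₂ : K →+* ℝ} (hσ : σ₁ ≠ σ₂) {m : ℕ} (hm : 1 ≤ m) :
    ∃ δ > 0, ∀ g,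
      |Real.log (σ₁ ((((unitHom m g : totallyPositiveUnits K) : (𝓞 K)ˣ) : 𝓞 K) : K))| < δ →
      |Real.log (σ₂ ((((unitHom m g : totallyPositiveUnits K) : (𝓞 K)ˣ) : 𝓞 K) : K))| < δ →
      g = 1 := by
  set s := σ₁ wK with hs
  have h1 := one_lt_map_wK_sq σ₁
  have h4 := map_wK_pow_four σ₁
  rw [← hs] at h1 h4
  have hs2 : s ^ 2 < 2 := by nlinarith
  have hL : Real.log (s ^ 2 - 1) ≠ 0 := (Real.log_neg (by linarith) (by linarith)).ne
  have hP : Real.log (s + 1) - Real.log (-s + 1) ≠ 0 := by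
    rw [sub_ne_zero, ← Real.log_abs, ← Real.log_abs (-s + 1)]
    intro h
    have ha : s + 1 ≠ 0 := fun h => by nlinarith
    have hb : -s + 1 ≠ 0 := fun h => by nlinarith
    have h5 := Real.log_injOn_pos (abs_pos.2 ha) (abs_pos.2 hb) h
    have h6 := (sq_eq_sq_iff_abs_eq_abs _ _).2 h5
    nlinarith
  -- With exponents `a`, `b`, the two logarithms share the summand `a m log (s ^ 2 - 1)`, since `σ₂
  -- w = -s`. Their difference is `2 b` times `log (s + 1) - log (-s + 1)`, so the first bound
  -- forces `b = 0`; the second then forces `a = 0`.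
  refine ⟨min |Real.log (s + 1) - Real.log (-s + 1)| |Real.log (s ^ 2 - 1)|,
    lt_min (abs_pos.2 hP) (abs_pos.2 hL), fun g hg1 hg2 => ?_⟩
  rw [log_map_unitHom hσ] at hg1 hg2
  rw [map_wK_neg hσ, neg_sq] at hg2
  rw [← hs] at hg1 hg2
  have hb : g.2.toAdd = 0 := by
    have h : |(g.2.toAdd : ℝ) * 2 * (Real.log (s + 1) - Real.log (-s + 1))| <
        2 * |Real.log (s + 1) - Real.log (-s + 1)| := by
      have ha := hg1.trans_le (min_le_left _ _)
      have hb := hg2.trans_le (min_le_left _ _)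
      calc _ = |(g.1.toAdd * m * Real.log (s ^ 2 - 1) + g.2.toAdd * 2 * Real.log (s + 1)) -
            (g.1.toAdd * m * Real.log (s ^ 2 - 1) + g.2.toAdd * 2 * Real.log (-s + 1))| := by
              congr 1; ring
        _ ≤ _ := abs_sub _ _
        _ < _ := by linarith
    rw [abs_mul, mul_lt_mul_iff_left₀ (abs_pos.2 hP), abs_mul, abs_two] at h
    exact Int.abs_lt_one_iff.1 (by exact_mod_cast (by linarith : |(g.2.toAdd : ℝ)| < 1))
  have ha : g.1.toAdd = 0 := by
    have h := hg1.trans_le (min_le_right _ _)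
    rw [hb, Int.cast_zero, zero_mul, zero_mul, add_zero, abs_mul] at h
    have h' : |(g.1.toAdd : ℝ) * m| < 1 := by
      by_contra hc
      push Not at hc
      exact absurd h (not_lt.2 (le_mul_of_one_le_left (abs_nonneg _) hc))
    refine int_eq_zero_of_abs_lt (a := m) (by exact_mod_cast hm) (mul_comm _ _) h'
  exact Prod.ext ha hb

lemma unitHom_injective {σ₁ σ₂ : K →+* ℝ} (hσ : σ₁ ≠ σ₂) {m : ℕ} (hm : 1 ≤ m) :
    Function.Injective (unitHom m) := by
  rw [injective_iff_map_eq_one]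
  intro g hg
  obtain ⟨δ, hδ, h⟩ := exists_forall_abs_log_lt hσ hm
  exact h g (by simpa [hg] using hδ) (by simpa [hg] using hδ)

lemma matrixAction_apply (a b : ℕ) (g : Multiplicative ℤ × Multiplicative ℤ)
    (x : Multiplicative (Fin 4 → ℤ)) : matrixAction a b g x = Multiplicative.ofAdd
      ((((M ^ a) ^ g.1.toAdd * (N ^ b) ^ g.2.toAdd : GL (Fin 4) ℤ) :
        Matrix (Fin 4) (Fin 4) ℤ).mulVec x.toAdd) := rfl

lemma intertwiningSubgroup_mem {A B : GL (Fin 4) ℤ} {k l : (𝓞 K)ˣ}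
    (hA : (A, k) ∈ intertwiningSubgroup) (hB : (B, l) ∈ intertwiningSubgroup) (a b : ℕ) (s t : ℤ) :
    ((A ^ a) ^ s * (B ^ b) ^ t, (k ^ a) ^ s * (l ^ b) ^ t) ∈ intertwiningSubgroup := by
  have h := mul_mem (zpow_mem (pow_mem hA a) s) (zpow_mem (pow_mem hB b) t)
  simpa only [Prod.pow_mk, Prod.mk_mul_mk] using h

lemma unitAction_apply {U : Subgroup (totallyPositiveUnits K)} (k : U)
    (x : Multiplicative (𝓞 K)) : unitAction U k x =
      Multiplicative.ofAdd ((((k : totallyPositiveUnits K) : (𝓞 K)ˣ) : 𝓞 K) * x.toAdd) := rfl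

lemma coordEquiv_matrixAction {σ₁ σ₂ : K →+* ℝ} (hσ : σ₁ ≠ σ₂) (m : ℕ)
    (g : Multiplicative ℤ × Multiplicative ℤ) (x : Multiplicative (Fin 4 → ℤ)) :
    AddEquiv.toMultiplicative coordEquiv (matrixAction m 2 g x) =
      unitAction (unitGroup m 1) (unitHom m g) (AddEquiv.toMultiplicative coordEquiv x) := by
  have h := intertwiningSubgroup_mem M_u_mem N_v_mem m 2 g.1.toAdd g.2.toAdd
  rw [matrixAction_apply, unitAction_apply, unitHom_coe hσ]
  have h' := h x.toAdd
  simp only at h'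
  change Multiplicative.ofAdd (coordEquiv _) = Multiplicative.ofAdd (_ * coordEquiv x.toAdd)
  rw [← h']
  rfl

/-- The group `𝓞 K ⋊ U_{m,1}` in coordinates. -/
lemma nonempty_matrixGroup_mulEquiv {σ₁ σ₂ : K →+* ℝ} (hσ : σ₁ ≠ σ₂) {m : ℕ} (hm : 1 ≤ m) :
    Nonempty (MatrixGroup m 2 ≃* OTGroup (unitGroup m 1)) :=
  ⟨SemidirectProduct.congr (AddEquiv.toMultiplicative coordEquiv)
    (MulEquiv.ofBijective (unitHom m) ⟨unitHom_injective hσ hm, unitHom_surjective m⟩)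
    fun g => MulEquiv.ext fun x => coordEquiv_matrixAction hσ m g x⟩

end OTManifold

end

/-! ### The covering and its fundamental group -/

noncomputable section

namespace OTManifold

open Topology Filter

section Action

variable {U : Subgroup (totallyPositiveUnits K)}

lemma continuous_actH (σ : K →+* ℝ) (g : OTGroup U) : Continuous (actH σ g) := by
  rw [UpperHalfPlane.isEmbedding_coe.continuous_iff]
  have h : (UpperHalfPlane.coe ∘ actH σ g) =
      fun z : ℍ => (σ g.trans : ℂ) + (σ g.scale : ℂ) * (z : ℂ) := funext (coe_actH σ g)
  rw [h]
  exact continuous_const.add (continuous_const.mul UpperHalfPlane.continuous_coe)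

lemma im_actH (σ : K →+* ℝ) (g : OTGroup U) (z : ℍ) : (actH σ g z).im = σ g.scale * z.im := by
  rw [← UpperHalfPlane.coe_im, coe_actH]
  simp

lemma re_actH (σ : K →+* ℝ) (g : OTGroup U) (z : ℍ) :
    (actH σ g z).re = σ g.trans + σ g.scale * z.re := by
  rw [← UpperHalfPlane.coe_re, coe_actH]
  simp

lemma log_im_actH (σ : K →+* ℝ) (g : OTGroup U) (z : ℍ) :
    Real.log (actH σ g z).im = Real.log (σ g.scale) + Real.log z.im := by
  rw [im_actH, Real.log_mul (g.scale_pos σ).ne' z.im_pos.ne']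

end Action

/-- Every point has a neighbourhood whose points are uniformly close to each other in the real
parts, the logarithms of the imaginary parts, and the last coordinate. -/
lemma exists_nhds_close (e : ℍ × ℍ × ℂ) {δ : ℝ} (hδ : 0 < δ) :
    ∃ V ∈ 𝓝 e, ∀ p ∈ V, ∀ q ∈ V,
      |Real.log q.1.im - Real.log p.1.im| < δ ∧ |Real.log q.2.1.im - Real.log p.2.1.im| < δ ∧
      |q.1.re - p.1.re| < 1 ∧ |q.2.1.re - p.2.1.re| < 1 ∧ ‖q.2.2 - p.2.2‖ < 1 := by
  have key {E : Type} [SeminormedAddCommGroup E] {f : ℍ × ℍ × ℂ → E} (hf : Continuous f) {r : ℝ}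
      (hr : 0 < r) : ∀ᶠ x : (ℍ × ℍ × ℂ) × (ℍ × ℍ × ℂ) in 𝓝 e ×ˢ 𝓝 e, ‖f x.2 - f x.1‖ < r := by
    have hc : Continuous fun x : (ℍ × ℍ × ℂ) × (ℍ × ℍ × ℂ) => ‖f x.2 - f x.1‖ := by fun_prop
    rw [← nhds_prod_eq]
    exact hc.continuousAt.eventually_lt continuousAt_const (by simpa using hr)
  have hlog : Continuous fun z : ℍ => Real.log z.im :=
    UpperHalfPlane.continuous_im.log fun z => z.im_pos.ne'
  have h := (key (hlog.comp continuous_fst) hδ).and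
    ((key (hlog.comp (continuous_fst.comp continuous_snd)) hδ).and
    ((key (UpperHalfPlane.continuous_re.comp continuous_fst) one_pos).and
    ((key (UpperHalfPlane.continuous_re.comp (continuous_fst.comp continuous_snd)) one_pos).and
    (key (continuous_snd.comp continuous_snd) one_pos))))
  obtain ⟨V, hV, hVV⟩ := mem_prod_same_iff.1 h
  exact ⟨V, hV, fun p hp q hq => hVV (Set.mk_mem_prod hp hq)⟩

/-- Imaginary parts do not see translations, so they kill the unit part first; with scale `1`, the
displacements in the real parts and in the last coordinate are the conjugates of the translation. -/
lemma eq_one_of_close {σ₁ σ₂ : K →+* ℝ} (hσ : σ₁ ≠ σ₂) {σ₃ : K →+* ℂ}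
    (hσ₃ : ¬ NumberField.ComplexEmbedding.IsReal σ₃) {m : ℕ} {δ : ℝ}
    (hδ : ∀ g,
      |Real.log (σ₁ ((((unitHom m g : totallyPositiveUnits K) : (𝓞 K)ˣ) : 𝓞 K) : K))| < δ →
      |Real.log (σ₂ ((((unitHom m g : totallyPositiveUnits K) : (𝓞 K)ˣ) : 𝓞 K) : K))| < δ →
      g = 1) (g : OTGroup (unitGroup m 1)) (p : ℍ × ℍ × ℂ)
    (h1 : |Real.log (actH σ₁ g p.1).im - Real.log p.1.im| < δ)
    (h2 : |Real.log (actH σ₂ g p.2.1).im - Real.log p.2.1.im| < δ)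
    (h3 : |(actH σ₁ g p.1).re - p.1.re| < 1) (h4 : |(actH σ₂ g p.2.1).re - p.2.1.re| < 1)
    (h5 : ‖σ₃ g.trans + σ₃ g.scale * p.2.2 - p.2.2‖ < 1) : g = 1 := by
  rw [log_im_actH, add_sub_cancel_right] at h1 h2
  have hr : g.right = 1 := by
    obtain ⟨k, hk⟩ := unitHom_surjective m g.right
    rw [OTGroup.scale, ← hk] at h1 h2
    rw [← hk, hδ k h1 h2, map_one]
  have hs : g.scale = 1 := by simp [OTGroup.scale, hr]
  rw [re_actH, hs, map_one, one_mul, add_sub_cancel_right] at h3 h4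
  rw [hs, map_one, one_mul, add_sub_cancel_right] at h5
  exact SemidirectProduct.ext (eq_zero_of_map_small hσ hσ₃ g.left.toAdd h3 h4 h5) hr

lemma isQuotientCoveringMap_mk {σ₁ σ₂ : K →+* ℝ} (hσ : σ₁ ≠ σ₂) {σ₃ : K →+* ℂ}
    (hσ₃ : ¬ NumberField.ComplexEmbedding.IsReal σ₃) {m : ℕ} (hm : 1 ≤ m) :
    letI := otAction σ₁ σ₂ σ₃ (unitGroup m 1)
    IsQuotientCoveringMap (Quotient.mk _ : ℍ × ℍ × ℂ → X σ₁ σ₂ σ₃ m 1)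
      (OTGroup (unitGroup m 1)) := by
  let := otAction σ₁ σ₂ σ₃ (unitGroup m 1)
  refine { isQuotientMap_quotient_mk' with
    continuous_const_smul := fun g => ?_
    apply_eq_iff_mem_orbit := Quotient.eq
    disjoint := fun e => ?_ }
  · exact ((continuous_actH σ₁ g).comp continuous_fst).prodMk
      (((continuous_actH σ₂ g).comp (continuous_fst.comp continuous_snd)).prodMk
        (continuous_const.add (continuous_const.mul (continuous_snd.comp continuous_snd))))
  · obtain ⟨δ, hδ, h⟩ := exists_forall_abs_log_lt hσ hm
    obtain ⟨V, hV, hVV⟩ := exists_nhds_close e hδ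
    refine ⟨V, hV, fun g => ?_⟩
    rintro ⟨_, ⟨p, hp, rfl⟩, hq⟩
    obtain ⟨h1, h2, h3, h4, h5⟩ := hVV p hp _ hq
    exact eq_one_of_close hσ hσ₃ h g p h1 h2 h3 h4 h5

lemma nonempty_fundamentalGroup_mulEquiv {σ₁ σ₂ : K →+* ℝ} (hσ : σ₁ ≠ σ₂) {σ₃ : K →+* ℂ}
    (hσ₃ : ¬ NumberField.ComplexEmbedding.IsReal σ₃) {m : ℕ} (hm : 1 ≤ m)
    (x : X σ₁ σ₂ σ₃ m 1) :
    Nonempty (FundamentalGroup (X σ₁ σ₂ σ₃ m 1) x ≃* MatrixGroup m 2) := by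
  let := otAction σ₁ σ₂ σ₃ (unitGroup m 1)
  obtain ⟨e, rfl⟩ := Quotient.exists_rep x
  obtain ⟨f⟩ := nonempty_matrixGroup_mulEquiv hσ hm
  -- The covering identifies the fundamental group with the opposite of the acting group; inversion
  -- removes the opposite.
  exact ⟨((isQuotientCoveringMap_mk hσ hσ₃ hm).fundamentalGroupEquiv ⟨e, rfl⟩).trans
    ((MulEquiv.inv' (OTGroup (unitGroup m 1))).symm.trans f.symm)⟩

instance (σ₁ σ₂ : K →+* ℝ) (σ₃ : K →+* ℂ) (m n : ℕ) :
    PathConnectedSpace (X σ₁ σ₂ σ₃ m n) :=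
  Quotient.mk_surjective.pathConnectedSpace continuous_quotient_mk'

lemma nonempty_H₁_addEquiv {σ₁ σ₂ : K →+* ℝ} (hσ : σ₁ ≠ σ₂) {σ₃ : K →+* ℂ}
    (hσ₃ : ¬ NumberField.ComplexEmbedding.IsReal σ₃) {m : ℕ} (hm : 1 ≤ m) :
    Nonempty (H₁ (X σ₁ σ₂ σ₃ m 1) ≃+ Additive (Abelianization (MatrixGroup m 2))) := by
  obtain ⟨x⟩ : Nonempty (X σ₁ σ₂ σ₃ m 1) := inferInstance
  obtain ⟨f⟩ := nonempty_fundamentalGroup_mulEquiv hσ hσ₃ hm x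
  obtain ⟨g⟩ : Nonempty (H₁ (X σ₁ σ₂ σ₃ m 1) ≃+ _) := hurewicz_one (X σ₁ σ₂ σ₃ m 1) x
  exact ⟨g.trans f.abelianizationCongr.toAdditive⟩

end OTManifold

end

theorem proposition3 (m : ℕ) (hm : 1 ≤ m)
    (σ₁ σ₂ : OTManifold.K →+* ℝ) (hσ : σ₁ ≠ σ₂)
    (σ₃ : OTManifold.K →+* ℂ) (hσ₃ : ¬ NumberField.ComplexEmbedding.IsReal σ₃) :
    (∀ x : OTManifold.X σ₁ σ₂ σ₃ m 1,
      Nonempty (FundamentalGroup (OTManifold.X σ₁ σ₂ σ₃ m 1) x ≃*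
        Multiplicative (Fin 4 → ℤ) ⋊[OTManifold.matrixAction m 2]
          (Multiplicative ℤ × Multiplicative ℤ))) ∧
    (¬ 6 ∣ m →
      Nonempty (OTManifold.H₁ (OTManifold.X σ₁ σ₂ σ₃ m 1) ≃+
        (ZMod 2 × ZMod 2) × (ℤ × ℤ))) ∧
    (6 ∣ m →
      Nonempty (OTManifold.H₁ (OTManifold.X σ₁ σ₂ σ₃ m 1) ≃+
        (ZMod 2 × ZMod 2) × ZMod 7 × (ℤ × ℤ))) := by
  obtain ⟨f⟩ := OTManifold.nonempty_H₁_addEquiv hσ hσ₃ hm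
  refine ⟨OTManifold.nonempty_fundamentalGroup_mulEquiv hσ hσ₃ hm, fun h => ?_, fun h => ?_⟩
  · obtain ⟨g⟩ := OTManifold.abelianization_of_not_dvd h
    exact ⟨f.trans g⟩
  · obtain ⟨g⟩ := OTManifold.abelianization_of_dvd h
    exact ⟨f.trans g⟩
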